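/- Let $m\in\mathbb N_0$, let $\mathbb T$ be $\mathbb R$ or $\mathbb Z$ (or, more generally, any abelian topological group), and let $\mathbb S^\infty$ be the unit sphere of the Hilbert space $\ell^2(\mathbb N)$ with the spherical distance $\vartheta(x,y)=\arccos\langle x,y\rangle$. A second-order $m$-variate random field $\{Z(x;t):x\in\mathbb S^\infty,\,t\in\mathbb T\}$ is called isotropic over $\mathbb S^\infty$ and stationary on $\mathbb T$, with covariance matrix function $C(\vartheta;t)$, if its mean is constant and $\operatorname{cov}(Z(x;s),Z(y;t))=C(\vartheta(x,y);s-t)$ for all $x,y\in\mathbb S^\infty$, $s,t\in\mathbb T$. It is Gaussian (elliptically contoured) if all its finite-dimensional distributions are; a random vector is elliptically contoured if its characteristic function has the form $a\mapsto e^{i a'\mu}\varphi(a'\Sigma a)$ with a vector $\mu$, a positive semidefinite matrix $\Sigma$ and a function $\varphi$. A matrix function $B:\mathbb T\to\mathbb R^{m\times m}$ is a stationary covariance matrix function on $\mathbb T$ if there is a second-order $m$-variate stochastic process $\{W(t):t\in\mathbb T\}$ with constant mean and $\operatorname{cov}(W(s),W(t))=B(s-t)$ for all $s,t\in\mathbb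 T$. (i) If the $m$-variate random field $\{Z(x;t)\}$ is isotropic over $\mathbb S^\infty$ and stationary on $\mathbb T$ with covariance matrix function $C(\vartheta;t)$, and $x\mapsto Z(x;t)$ is mean square continuous on $\mathbb S^\infty$ for every $t$, then there are $m\times m$ matrix functions $B_n(t)$, $n\in\mathbb N_0$, with $$\frac{C(\vartheta;t)+C(\vartheta;-t)}2=\sum_{n=0}^\infty B_n(t)\cos^n\vartheta,\qquad \vartheta\in[0,\pi],\ t\in\mathbb T,$$ where, for each fixed $t$, the matrices $B_n(t)$ are symmetric and $\sum_{n=0}^\infty B_n(t)$ converges and, for each fixed $n$, $B_n$ is a stationary covariance matrix function on $\mathbb T$. In particular, if $C(\vartheta;-t)=C(\vartheta;t)$ for all $\vartheta\in[0,\pi]$ and $t\in\mathbb T$, then $C(\vartheta;t)=\sum_{n=0}^\infty B_n(t)\cos^n\vartheta$ for all $\vartheta\in[0,\pi]$, $t\in\mathbb T$. If moreover $C(\vartheta;\cdot)$ is continuous on $\mathbb T$ for every $\vartheta\in[0,\pi]$, then every $B_n$ is continuous. (ii) Let $B_n:\mathbb T\to\mathbb R^{m\times m}$, $n\in\mathbb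 N_0$ (not necessarily with symmetric values). The following are equivalent: (a) the series $C(\vartheta;t)=\sum_{n=0}^\infty B_n(t)\cos^n\vartheta$ converges for all $\vartheta\in[0,\pi]$, $t\in\mathbb T$, and $C$ is the covariance matrix function of an $m$-variate isotropic and stationary Gaussian random field on $\mathbb S^\infty\times\mathbb T$; (b) the same with "elliptically contoured" (of second order) in place of "Gaussian"; (c) $\sum_{n=0}^\infty B_n(0)$ converges and, for each $n\in\mathbb N_0$, $B_n$ is a stationary covariance matrix function on $\mathbb T$. In this case, $C(\vartheta;\cdot)$ is continuous on $\mathbb T$ for every $\vartheta\in[0,\pi]$ if and only if every $B_n$ is continuous. -/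

import Mathlib

open MeasureTheory ProbabilityTheory Filter Topology

open scoped lp

/-- The unit sphere of the real Hilbert space `ℓ²(ℕ, ℝ)`. -/
abbrev SphereInf : Type := Metric.sphere (0 : ℓ²(ℕ, ℝ)) 1

/-- The spherical (geodesic) distance of two points of the infinite-dimensional sphere. -/
noncomputable def sphericalDist (x y : SphereInf) : ℝ :=
  Real.arccos (inner ℝ (x : ℓ²(ℕ, ℝ)) (y : ℓ²(ℕ, ℝ)))

/-- The `m`-variate random field `Z` on `SphereInf × T` is of second order, (wide-sense) isotropic
over the sphere and (wide-sense) stationary over `T`, with covariance matrix function `C`: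
its mean is constant, and `cov (Z (x; s), Z (y; t)) = C (ϑ(x, y); s - t)`. -/
structure IsIsotropicStationary {Ω T : Type*} [MeasurableSpace Ω] [AddCommGroup T] {m : ℕ}
    (P : Measure Ω) (Z : SphereInf → T → Ω → EuclideanSpace ℝ (Fin m))
    (C : ℝ → T → Matrix (Fin m) (Fin m) ℝ) : Prop where
  memLp : ∀ x t, MemLp (Z x t) 2 P
  mean_const : ∃ c : EuclideanSpace ℝ (Fin m), ∀ x t, ∫ ω, Z x t ω ∂P = c
  cov_eq : ∀ x y s t i j,
    cov[fun ω => Z x s ω i, fun ω => Z y t ω j; P] = C (sphericalDist x y) (s - t) i j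

/-- The field `Z` is mean square continuous over the sphere, at each time. -/
def IsMeanSquareContinuous {Ω T : Type*} [MeasurableSpace Ω] {m : ℕ}
    (P : Measure Ω) (Z : SphereInf → T → Ω → EuclideanSpace ℝ (Fin m)) : Prop :=
  ∀ t x, Tendsto (fun y => ∫ ω, ‖Z y t ω - Z x t ω‖ ^ 2 ∂P) (𝓝 x) (𝓝 0)

/-- `B` is a stationary covariance matrix function on `T`: it is the covariance matrix function
of an `m`-variate second-order stochastic process with constant mean whose covariance
`cov (W s, W t)` equals `B (s - t)`. -/
def IsStationaryCovariance {T : Type} [AddCommGroup T] {m : ℕ}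
    (B : T → Matrix (Fin m) (Fin m) ℝ) : Prop :=
  ∃ (Ω : Type) (_ : MeasurableSpace Ω) (P : Measure Ω) (W : T → Ω → EuclideanSpace ℝ (Fin m)),
    IsProbabilityMeasure P ∧ (∀ t, MemLp (W t) 2 P) ∧
    (∃ c : EuclideanSpace ℝ (Fin m), ∀ t, ∫ ω, W t ω ∂P = c) ∧
    ∀ s t i j, cov[fun ω => W s ω i, fun ω => W t ω j; P] = B (s - t) i j

/-- The real random vector `X` has an elliptically contoured distribution: for a location vector
`μ`, a positive semidefinite scale matrix `S` and a generator `φ`, its characteristic function is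
`a ↦ exp (i a'μ) φ(a'Sa)`. -/
def IsEllipticallyContoured {Ω ι : Type*} [MeasurableSpace Ω] [Fintype ι]
    (P : Measure Ω) (X : Ω → ι → ℝ) : Prop :=
  AEMeasurable X P ∧
  ∃ (μ : ι → ℝ) (S : Matrix ι ι ℝ) (φ : ℝ → ℂ), S.PosSemidef ∧
    ∀ a : ι → ℝ,
      ∫ ω, Complex.exp (Complex.I * ((a ⬝ᵥ X ω : ℝ) : ℂ)) ∂P =
        Complex.exp (Complex.I * ((a ⬝ᵥ μ : ℝ) : ℂ)) * φ (a ⬝ᵥ (S.mulVec a))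

/-- The `m`-variate field `Z` is elliptically contoured: all its finite-dimensional distributions
are. -/
def IsEllipticallyContouredField {Ω T : Type*} [MeasurableSpace Ω] {m : ℕ}
    (P : Measure Ω) (Z : SphereInf → T → Ω → EuclideanSpace ℝ (Fin m)) : Prop :=
  ∀ I : Finset (SphereInf × T),
    IsEllipticallyContoured P (fun ω (p : I × Fin m) => Z p.1.1.1 p.1.1.2 ω p.2)

/-- `C` is the covariance matrix function of an `m`-variate Gaussian random field. -/
def IsGaussianFieldCovariance {T : Type} [AddCommGroup T] {m : ℕ}
    (C : ℝ → T → Matrix (Fin m) (Fin m) ℝ) : Prop :=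
  ∃ (Ω : Type) (_ : MeasurableSpace Ω) (P : Measure Ω)
    (Z : SphereInf → T → Ω → EuclideanSpace ℝ (Fin m)),
    IsProbabilityMeasure P ∧ IsIsotropicStationary P Z C ∧
    IsGaussianProcess (fun p : SphereInf × T => Z p.1 p.2) P

/-- `C` is the covariance matrix function of an `m`-variate (second-order) elliptically contoured
random field. -/
def IsEllipticalFieldCovariance {T : Type} [AddCommGroup T] {m : ℕ}
    (C : ℝ → T → Matrix (Fin m) (Fin m) ℝ) : Prop :=
  ∃ (Ω : Type) (_ : MeasurableSpace Ω) (P : Measure Ω)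
    (Z : SphereInf → T → Ω → EuclideanSpace ℝ (Fin m)),
    IsProbabilityMeasure P ∧ IsIsotropicStationary P Z C ∧ IsEllipticallyContouredField P Z

/-- The series `∑ n, A n` of matrices converges to `S` (ordinary convergence of the partial
sums). -/
def SeriesConvergesTo {m : ℕ} (A : ℕ → Matrix (Fin m) (Fin m) ℝ)
    (S : Matrix (Fin m) (Fin m) ℝ) : Prop :=
  Tendsto (fun N => ∑ n ∈ Finset.range N, A n) atTop (𝓝 S)

/-- `C (ϑ; t) = ∑ n, B n t * cos ϑ ^ n` for all `ϑ ∈ [0, π]` and all `t`. -/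
def HasCosPowerSeries {T : Type*} {m : ℕ} (B : ℕ → T → Matrix (Fin m) (Fin m) ℝ)
    (C : ℝ → T → Matrix (Fin m) (Fin m) ℝ) : Prop :=
  ∀ θ ∈ Set.Icc (0 : ℝ) Real.pi, ∀ t,
    SeriesConvergesTo (fun n => Real.cos θ ^ n • B n t) (C θ t)

/-! ### Closure properties of positive semidefinite kernels. -/

section PosSemidef

variable {ι : Type*}

/-! Everything is translated into positive semidefiniteness of scalar kernels: `stationaryKernel B`
on `T × Fin m` and `isotropicKernel C` on `SphereInf × (T × Fin m)`. Covariances are positive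
semidefinite; conversely, a positive semidefinite kernel is a Gram matrix in a Hilbert space, and
composing with an isonormal process turns it into the covariance of a centred Gaussian process,
whose finite-dimensional laws are elliptically contoured
(`Matrix.PosSemidef.exists_multivariate_gaussian`).

The sufficient direction is the Schur product theorem: powers of the inner product are positive
semidefinite, hence so are their products with `stationaryKernel (B n)` and the sums of these.

The converse is a Schoenberg theorem, `exists_posSemidef_hasSum_pow`, proved with discrete cubes
instead of Gegenbauer polynomials. The cube with vertices `ε / √N` lies on the sphere, and the inner
product of two vertices is the mean of the coordinates of `ε * ε'`. Averaging the kernel against a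
character of the group of signs shows that each Walsh coefficient of `ε ↦ f (mean ε)` is a positive
semidefinite matrix. Summed over the characters of degree `k` and multiplied by `ρ ^ k`, these
coefficients add up to the Bernstein polynomial of `f`, rescaled to `[-1, 1]`, which tends to `f ρ`.
A limit of the coefficients along an ultrafilter gives the power series.

Uniqueness of power series makes the coefficients depend on time differences only
(`exists_stationary_hasSum_pow`). Continuity in `ρ`, needed for Bernstein approximation, comes from
mean square continuity in (i) and from Abel's theorem in (ii). -/

theorem Matrix.PosSemidef.sum_mul_mul_nonneg {K : Matrix ι ι ℝ} (hK : K.PosSemidef)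
    {κ : Type*} [Fintype κ] (f : κ → ι) (a : κ → ℝ) :
    0 ≤ ∑ k, ∑ l, a k * a l * K (f k) (f l) := by
  have h := (hK.submatrix f).dotProduct_mulVec_nonneg a
  refine h.trans_eq ?_
  simp only [dotProduct, Matrix.mulVec, Matrix.submatrix_apply, Pi.star_apply, star_trivial,
    Finset.mul_sum]
  exact Finset.sum_congr rfl fun i _ => Finset.sum_congr rfl fun j _ => by ring

theorem Matrix.PosSemidef.apply_comm {K : Matrix ι ι ℝ} (hK : K.PosSemidef) (i j : ι) :
    K i j = K j i := by
  simpa using hK.isHermitian.apply j i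

theorem Matrix.posSemidef_of_finset_sum {K : Matrix ι ι ℝ} (hsymm : ∀ i j, K i j = K j i)
    (h : ∀ (s : Finset ι) (a : ι → ℝ), 0 ≤ ∑ k ∈ s, ∑ l ∈ s, a k * a l * K k l) :
    K.PosSemidef := by
  refine ⟨?_, fun x => ?_⟩
  · ext i j
    simpa using hsymm j i
  · have := h x.support x
    simp only [Finsupp.sum, star_trivial]
    refine this.trans_eq ?_
    exact Finset.sum_congr rfl fun i _ => Finset.sum_congr rfl fun j _ => by ring

theorem Matrix.PosSemidef.abs_apply_le {K : Matrix ι ι ℝ} (hK : K.PosSemidef) (i j : ι) :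
    |K i j| ≤ (K i i + K j j) / 2 := by
  have h1 := hK.sum_mul_mul_nonneg ![i, j] ![1, 1]
  have h2 := hK.sum_mul_mul_nonneg ![i, j] ![1, -1]
  have h3 := hK.apply_comm i j
  simp [Fin.sum_univ_two] at h1 h2
  rw [abs_le]
  constructor <;> linarith

theorem Matrix.posSemidef_of_tendsto {α : Type*} {l : Filter α} [l.NeBot]
    {K : α → Matrix ι ι ℝ} {K' : Matrix ι ι ℝ} (hK : ∀ᶠ n in l, (K n).PosSemidef)
    (h : ∀ i j, Tendsto (fun n => K n i j) l (𝓝 (K' i j))) : K'.PosSemidef := by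
  refine Matrix.posSemidef_of_finset_sum (fun i j => ?_) fun s a => ?_
  · refine tendsto_nhds_unique_of_eventuallyEq (h i j) (h j i) ?_
    filter_upwards [hK] with n hn using hn.apply_comm i j
  · refine ge_of_tendsto (tendsto_finsetSum _ fun k _ => tendsto_finsetSum _ fun m _ =>
      (h k m).const_mul (a k * a m)) ?_
    filter_upwards [hK] with n hn
    have := hn.sum_mul_mul_nonneg (fun k : s => (k : ι)) (fun k : s => a k)
    refine this.trans_eq ?_
    rw [← Finset.sum_coe_sort s]
    exact Finset.sum_congr rfl fun k _ => Finset.sum_coe_sort s fun l => a k * a l * K n k l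

theorem Matrix.posSemidef_of_hasSum {K : ℕ → Matrix ι ι ℝ} {K' : Matrix ι ι ℝ}
    (hK : ∀ n, (K n).PosSemidef) (h : ∀ i j, HasSum (fun n => K n i j) (K' i j)) :
    K'.PosSemidef := by
  refine Matrix.posSemidef_of_tendsto (l := atTop)
    (K := fun N => ∑ n ∈ Finset.range N, K n)
    (Eventually.of_forall fun N => Matrix.posSemidef_sum _ fun n _ => hK n) fun i j => ?_
  simpa [Matrix.sum_apply] using (h i j).tendsto_sum_nat

/-- The quadratic form with coefficients `a` is that of `K` at the points `(u g, k)` with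
coefficients `a k * w g`. -/
theorem Matrix.posSemidef_weighted_sum {X G : Type*} [Fintype G]
    {K : Matrix (X × ι) (X × ι) ℝ} (hK : K.PosSemidef) (w : G → ℝ) (u : G → X) :
    (Matrix.of fun p q => ∑ g, ∑ g', w g * w g' * K (u g, p) (u g', q)).PosSemidef := by
  refine Matrix.posSemidef_of_finset_sum (fun i j => ?_) fun s a => ?_
  · simp only [Matrix.of_apply]
    rw [Finset.sum_comm]
    refine Finset.sum_congr rfl fun g _ => Finset.sum_congr rfl fun g' _ => ?_
    rw [hK.apply_comm, mul_comm (w g)]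
  · have := hK.sum_mul_mul_nonneg (fun k : s × G => (u k.2, (k.1 : ι)))
      (fun k => a k.1 * w k.2)
    refine this.trans_eq ?_
    simp only [Matrix.of_apply, Fintype.sum_prod_type]
    rw [← Finset.sum_coe_sort s]
    refine Finset.sum_congr rfl fun k _ => ?_
    rw [← Finset.sum_coe_sort s]
    simp_rw [Finset.mul_sum]
    rw [Finset.sum_comm]
    refine Finset.sum_congr rfl fun g _ => ?_
    rw [Finset.sum_comm]
    rw [Finset.sum_comm]
    refine Finset.sum_congr rfl fun l _ => Finset.sum_congr rfl fun g' _ => by ring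

theorem posSemidef_covariance {Ω : Type*} [MeasurableSpace Ω] {P : Measure Ω} [IsFiniteMeasure P]
    {X : ι → Ω → ℝ} (hX : ∀ i, MemLp (X i) 2 P) :
    (Matrix.of fun i j => cov[X i, X j; P]).PosSemidef := by
  refine Matrix.posSemidef_of_finset_sum (fun i j => covariance_comm _ _) fun s a => ?_
  have h := covariance_sum_sum' (μ := P) (s := s) (t := s) (X := fun i => a i • X i)
    (Y := fun i => a i • X i)
    (fun i _ => (hX i).const_smul _) (fun i _ => (hX i).const_smul _)
  have h' : 0 ≤ cov[∑ i ∈ s, a i • X i, ∑ i ∈ s, a i • X i; P] :=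
    integral_nonneg fun ω => mul_self_nonneg _
  rw [h] at h'
  refine h'.trans_eq (Finset.sum_congr rfl fun i _ => Finset.sum_congr rfl fun j _ => ?_)
  rw [covariance_smul_left, covariance_smul_right, Matrix.of_apply, mul_assoc]

theorem posSemidef_inner {E : Type*} [NormedAddCommGroup E] [InnerProductSpace ℝ E]
    (v : ι → E) : (Matrix.of fun i j => inner ℝ (v i) (v j)).PosSemidef := by
  refine Matrix.posSemidef_of_finset_sum (fun i j => real_inner_comm _ _) fun s a => ?_
  have h : 0 ≤ inner ℝ (∑ i ∈ s, a i • v i) (∑ i ∈ s, a i • v i) := real_inner_self_nonneg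
  rw [sum_inner] at h
  simp only [inner_sum] at h
  refine h.trans_eq (Finset.sum_congr rfl fun i _ => Finset.sum_congr rfl fun j _ => ?_)
  rw [real_inner_smul_left, real_inner_smul_right, Matrix.of_apply, mul_assoc]

theorem Matrix.posSemidef_of_one : (Matrix.of fun _ _ : ι => (1 : ℝ)).PosSemidef := by
  refine Matrix.posSemidef_of_finset_sum (fun i j => rfl) fun s a => ?_
  have h : 0 ≤ (∑ k ∈ s, a k) * ∑ k ∈ s, a k := mul_self_nonneg _
  simpa [Finset.sum_mul_sum] using h

/-- Iterated Schur product theorem, starting from the all-ones kernel. -/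
theorem Matrix.PosSemidef.map_pow {K : Matrix ι ι ℝ} (hK : K.PosSemidef) (n : ℕ) :
    (Matrix.of fun i j => K i j ^ n).PosSemidef := by
  induction n with
  | zero => simpa using Matrix.posSemidef_of_one
  | succ n ih =>
    have h : (Matrix.of fun i j => K i j ^ (n + 1)) = Matrix.hadamard (.of fun i j => K i j ^ n) K := by
      ext i j
      simp [pow_succ]
    rw [h]
    exact ih.hadamard hK

end PosSemidef

/-! ### Isonormal processes and Gaussian processes with prescribed covariance. -/

section Isonormal

variable {Ω : Type*} [MeasurableSpace Ω] {P : Measure Ω} [IsProbabilityMeasure P]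

/-- The map `x ↦ exp (i x)` is 1-Lipschitz, and the `L¹` norm is at most the `L²` norm on a
probability space. This carries characteristic function identities to `L²` limits. -/
theorem norm_integral_cexp_sub_le (f g : Lp ℝ 2 P) :
    ‖∫ ω, Complex.exp (f ω * Complex.I) ∂P - ∫ ω, Complex.exp (g ω * Complex.I) ∂P‖ ≤ ‖f - g‖ := by
  have hint (f : Lp ℝ 2 P) : Integrable (fun ω => Complex.exp (f ω * Complex.I)) P := by
    refine Integrable.of_bound (C := 1) ?_ (Eventually.of_forall fun ω => ?_)
    · have := (Lp.memLp f).1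
      exact Complex.continuous_exp.comp_aestronglyMeasurable
        ((Complex.continuous_ofReal.comp_aestronglyMeasurable this).mul_const _)
    · rw [Complex.norm_exp_ofReal_mul_I]
  have hfg : MemLp (fun ω => f ω - g ω) 2 P := (Lp.memLp f).sub (Lp.memLp g)
  rw [← integral_sub (hint f) (hint g)]
  have h1 : ‖∫ ω, (Complex.exp (f ω * Complex.I) - Complex.exp (g ω * Complex.I)) ∂P‖ ≤
      ∫ ω, ‖f ω - g ω‖ ∂P := by
    refine norm_integral_le_of_norm_le (hfg.integrable one_le_two).norm
      (Eventually.of_forall fun ω => ?_)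
    have h := Real.norm_exp_I_mul_ofReal_sub_one_le (x := f ω - g ω)
    have h2 : Complex.exp (f ω * Complex.I) - Complex.exp (g ω * Complex.I) =
        Complex.exp (g ω * Complex.I) * (Complex.exp (Complex.I * ((f ω - g ω : ℝ) : ℂ)) - 1) := by
      rw [mul_sub, ← Complex.exp_add, mul_one]
      congr 2
      push_cast
      ring
    rw [h2, norm_mul, Complex.norm_exp_ofReal_mul_I, one_mul]
    exact h
  refine h1.trans ?_
  rw [Lp.norm_def, eLpNorm_congr_ae (Lp.coeFn_sub f g)]
  have h2 : eLpNorm (fun ω => f ω - g ω) 1 P ≤ eLpNorm (fun ω => f ω - g ω) 2 P :=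
    eLpNorm_le_eLpNorm_of_exponent_le one_le_two hfg.1
  rw [integral_norm_eq_lintegral_enorm hfg.1, ← eLpNorm_one_eq_lintegral_enorm]
  exact ENNReal.toReal_mono hfg.2.ne h2

end Isonormal

section Isonormal

open scoped NNReal

variable {Ω ι : Type*} [MeasurableSpace Ω] {P : Measure Ω} {ξ : ι → Ω → ℝ}

theorem charFun_sum_smul_of_iIndepFun_gaussianReal (hlaw : ∀ i, HasLaw (ξ i) (gaussianReal 0 1) P)
    (hindep : iIndepFun ξ P) (s : Finset ι) (c : ι → ℝ) :
    ∫ ω, Complex.exp ((∑ i ∈ s, c i * ξ i ω : ℝ) * Complex.I) ∂P =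
      Complex.exp (-(∑ i ∈ s, c i ^ 2 : ℝ) / 2) := by
  have hm (i : ι) : AEMeasurable (fun ω => c i * ξ i ω) P := (hlaw i).aemeasurable.const_mul _
  have hc : iIndepFun (fun i ω => c i * ξ i ω) P :=
    hindep.comp (fun i x => c i * x) fun i => by fun_prop
  have h := (hc.restrict s).charFun_map_fun_finsetSum_eq_prod (fun i _ => hm i)
  have hsum : AEMeasurable (fun ω => ∑ i ∈ s, c i * ξ i ω) P :=
    Finset.aemeasurable_fun_sum s fun i _ => hm i
  have h1 := congrFun h 1
  rw [charFun_apply_real, integral_map hsum (by fun_prop)] at h1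
  simp only [Complex.ofReal_one, one_mul, Finset.prod_apply] at h1
  rw [h1]
  have h2 (i : ι) : charFun (P.map fun ω => c i * ξ i ω) 1 = Complex.exp (-(c i ^ 2 : ℝ) / 2) := by
    have h3 : (P.map fun ω => c i * ξ i ω) = (P.map (ξ i)).map (fun x => c i * x) := by
      rw [AEMeasurable.map_map_of_aemeasurable (by fun_prop) (hlaw i).aemeasurable]
      rfl
    rw [h3, (hlaw i).map_eq, gaussianReal_map_const_mul, charFun_gaussianReal]
    congr 1
    simp
    ring
  simp_rw [h2]
  rw [← Complex.exp_sum]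
  congr 1
  push_cast
  rw [← Finset.sum_div, Finset.sum_neg_distrib]

theorem orthonormal_toLp_of_iIndepFun_gaussianReal [IsProbabilityMeasure P]
    (hlaw : ∀ i, HasLaw (ξ i) (gaussianReal 0 1) P)
    (hindep : iIndepFun ξ P) (hmem : ∀ i, MemLp (ξ i) 2 P) :
    Orthonormal ℝ fun i => (hmem i).toLp := by
  classical
  have hmean (i : ι) : ∫ ω, ξ i ω ∂P = 0 := by
    rw [(hlaw i).integral_eq]; simp
  have hcov (i j : ι) : ∫ ω, ξ i ω * ξ j ω ∂P = if i = j then 1 else 0 := by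
    have h1 := covariance_eq_sub (hmem i) (hmem j)
    rw [hmean, zero_mul, sub_zero] at h1
    change ∫ ω, (ξ i * ξ j) ω ∂P = _
    rw [← h1]
    split_ifs with hij
    · subst hij
      rw [covariance_self (hlaw i).aemeasurable, (hlaw i).variance_eq]
      simp
    · exact (hindep.indepFun hij).covariance_eq_zero (hmem i) (hmem j)
  rw [orthonormal_iff_ite]
  intro i j
  rw [L2.inner_def, ← hcov i j]
  refine integral_congr_ae ?_
  filter_upwards [(hmem i).coeFn_toLp, (hmem j).coeFn_toLp] with ω h1 h2
  simp only [h1, h2]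
  simp [mul_comm]

/-- Independence gives the formula on finite combinations of basis vectors; these are dense and both
sides are continuous in `h`. -/
theorem integral_cexp_isometry_of_hilbertBasis {H : Type*} [NormedAddCommGroup H]
    [InnerProductSpace ℝ H] [IsProbabilityMeasure P] (b : HilbertBasis ι ℝ H)
    (hlaw : ∀ i, HasLaw (ξ i) (gaussianReal 0 1) P) (hindep : iIndepFun ξ P)
    (W : H →ₗᵢ[ℝ] Lp ℝ 2 P) (hW : ∀ i, W (b i) =ᵐ[P] ξ i) (h : H) :
    ∫ ω, Complex.exp (W h ω * Complex.I) ∂P = Complex.exp (-(‖h‖ ^ 2 : ℝ) / 2) := by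
  have hfin (s : Finset ι) (c : ι → ℝ) :
      ∫ ω, Complex.exp (W (∑ i ∈ s, c i • b i) ω * Complex.I) ∂P =
        Complex.exp (-(‖∑ i ∈ s, c i • b i‖ ^ 2 : ℝ) / 2) := by
    have hn : ‖∑ i ∈ s, c i • b i‖ ^ 2 = ∑ i ∈ s, c i ^ 2 := by
      rw [← real_inner_self_eq_norm_sq, b.orthonormal.inner_sum]
      simp [sq]
    rw [hn, ← charFun_sum_smul_of_iIndepFun_gaussianReal hlaw hindep]
    refine integral_congr_ae ?_
    have h1 : W (∑ i ∈ s, c i • b i) = ∑ i ∈ s, c i • W (b i) := by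
      rw [map_sum]
      exact Finset.sum_congr rfl fun i _ => map_smul W (c i) (b i)
    have h2 : ∀ᵐ ω ∂P, ∀ i ∈ s, (c i • W (b i) : Lp ℝ 2 P) ω = c i * ξ i ω := by
      rw [eventually_all_finset]
      intro i _
      filter_upwards [Lp.coeFn_smul (c i) (W (b i)), hW i] with ω h3 h4
      rw [h3, Pi.smul_apply, h4, smul_eq_mul]
    filter_upwards [Lp.coeFn_fun_finsetSum s fun i => c i • W (b i), h2] with ω h3 h4
    rw [h1, h3, Finset.sum_congr rfl h4]
  have hs : Tendsto (fun s : Finset ι => ∑ i ∈ s, b.repr h i • b i) atTop (𝓝 h) := b.hasSum_repr h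
  have hl : Tendsto (fun s : Finset ι =>
      ∫ ω, Complex.exp (W (∑ i ∈ s, b.repr h i • b i) ω * Complex.I) ∂P) atTop
      (𝓝 (∫ ω, Complex.exp (W h ω * Complex.I) ∂P)) := by
    rw [tendsto_iff_norm_sub_tendsto_zero]
    refine squeeze_zero (fun _ => norm_nonneg _) (fun s => norm_integral_cexp_sub_le _ _) ?_
    exact tendsto_iff_norm_sub_tendsto_zero.1 ((W.continuous.tendsto h).comp hs)
  refine tendsto_nhds_unique hl ?_
  simp_rw [hfin]
  have hc : Continuous fun x : H => Complex.exp (-(‖x‖ ^ 2 : ℝ) / 2) := by fun_prop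
  exact (hc.tendsto h).comp hs

/-- By linearity, the hypothesis at `t • h` is the characteristic function of `W h` at `t`. -/
theorem map_isometry_eq_gaussianReal {H : Type*} [NormedAddCommGroup H]
    [InnerProductSpace ℝ H] [IsProbabilityMeasure P] (W : H →ₗᵢ[ℝ] Lp ℝ 2 P)
    (hW : ∀ h, ∫ ω, Complex.exp (W h ω * Complex.I) ∂P = Complex.exp (-(‖h‖ ^ 2 : ℝ) / 2))
    (h : H) : HasLaw (W h) (gaussianReal 0 (‖h‖₊ ^ 2)) P := by
  have hm : AEMeasurable (W h) P := (Lp.aestronglyMeasurable (W h)).aemeasurable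
  refine ⟨hm, Measure.ext_of_charFun ?_⟩
  ext t
  rw [charFun_apply_real, integral_map hm (by fun_prop), charFun_gaussianReal]
  have h1 : ∫ ω, Complex.exp (t * (W h ω : ℂ) * Complex.I) ∂P =
      ∫ ω, Complex.exp (W (t • h) ω * Complex.I) ∂P := by
    refine integral_congr_ae ?_
    rw [map_smul]
    filter_upwards [Lp.coeFn_smul t (W h)] with ω hω
    rw [hω]
    simp
  rw [h1, hW, norm_smul, mul_pow]
  congr 1
  simp
  ring

end Isonormal

/-- Every Hilbert space carries an isonormal Gaussian process. -/
theorem exists_isonormal {H : Type} [NormedAddCommGroup H] [InnerProductSpace ℝ H]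
    [CompleteSpace H] :
    ∃ (Ω : Type) (_ : MeasurableSpace Ω) (P : Measure Ω) (_ : IsProbabilityMeasure P)
      (W : H →ₗᵢ[ℝ] Lp ℝ 2 P), ∀ h, HasLaw (W h) (gaussianReal 0 (‖h‖₊ ^ 2)) P := by
  classical
  obtain ⟨ι, b, -⟩ := exists_hilbertBasis ℝ H
  have hlaw (i : ι) : HasLaw (fun ω : ι → ℝ => ω i) (gaussianReal 0 1)
      (Measure.infinitePi fun _ : ι => gaussianReal 0 1) :=
    ⟨(measurable_pi_apply i).aemeasurable, Measure.infinitePi_map_eval _ i⟩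
  have hindep : iIndepFun (fun (i : ι) (ω : ι → ℝ) => ω i)
      (Measure.infinitePi fun _ : ι => gaussianReal 0 1) :=
    iIndepFun_infinitePi (X := fun (_ : ι) (x : ℝ) => x) fun _ => measurable_id
  have hmem (i : ι) := (hlaw i).hasGaussianLaw.memLp_two
  have hv := orthonormal_toLp_of_iIndepFun_gaussianReal hlaw hindep hmem
  refine ⟨ι → ℝ, inferInstance, Measure.infinitePi fun _ : ι => gaussianReal 0 1, inferInstance,
    hv.orthogonalFamily.linearIsometry.comp b.repr.toLinearIsometry, fun h => ?_⟩
  refine map_isometry_eq_gaussianReal _ (fun h =>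
    integral_cexp_isometry_of_hilbertBasis b hlaw hindep _ (fun i => ?_) h) h
  have h1 : hv.orthogonalFamily.linearIsometry.comp b.repr.toLinearIsometry (b i) =
      (hmem i).toLp := by
    simp [b.repr_self]
  rw [h1]
  exact (hmem i).coeFn_toLp

/-- A positive semidefinite kernel is the Gram matrix of a family of vectors in a Hilbert space. -/
theorem Matrix.PosSemidef.exists_inner_eq {ι : Type} {K : Matrix ι ι ℝ} (hK : K.PosSemidef) :
    ∃ (H : Type) (_ : NormedAddCommGroup H) (_ : InnerProductSpace ℝ H) (_ : CompleteSpace H)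
      (v : ι → H), ∀ i j, inner ℝ (v i) (v j) = K i j := by
  -- Reproducing kernels are operator-valued here, so scalar entries become multiples of the
  -- identity of `ℝ`.
  let A : Matrix ι ι (ℝ →L[ℝ] ℝ) := .of fun i j => K i j • 1
  have hA : A.PosSemidef := by
    have h : A.PosSemidef ↔ _ := (RKHS.posSemidef_tfae (K := A)).out 0 2
    refine h.2 ⟨?_, fun x => ?_⟩
    · ext i j
      simp [A, hK.apply_comm i j]
    · have := hK.2 x
      simp only [Finsupp.sum, A] at this ⊢
      refine this.trans_eq ?_
      simp
      refine Finset.sum_congr rfl fun i _ => Finset.sum_congr rfl fun j _ => ?_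
      rw [hK.apply_comm i j]
      ring
  have : Fact A.PosSemidef := ⟨hA⟩
  refine ⟨RKHS.OfKernel A, inferInstance, inferInstance, inferInstance,
    fun i => RKHS.kerFun (RKHS.OfKernel A) i 1, fun i j => ?_⟩
  rw [← RKHS.kernel_inner, RKHS.OfKernel.kernel_ofKernel]
  simp [A, hK.apply_comm i j]

/-- A positive semidefinite kernel is the covariance of a centred Gaussian process. -/
theorem Matrix.PosSemidef.exists_isGaussianProcess {ι : Type} {K : Matrix ι ι ℝ}
    (hK : K.PosSemidef) :
    ∃ (Ω : Type) (_ : MeasurableSpace Ω) (P : Measure Ω) (X : ι → Ω → ℝ),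
      IsProbabilityMeasure P ∧ IsGaussianProcess X P ∧ (∀ i, MemLp (X i) 2 P) ∧
      (∀ i, ∫ ω, X i ω ∂P = 0) ∧ ∀ i j, cov[X i, X j; P] = K i j := by
  classical
  obtain ⟨H, _, _, _, v, hv⟩ := hK.exists_inner_eq
  obtain ⟨Ω, _, P, _, W, hW⟩ := exists_isonormal (H := H)
  have hmean (i : ι) : ∫ ω, W (v i) ω ∂P = 0 := by
    rw [(hW (v i)).integral_eq]; simp
  refine ⟨Ω, inferInstance, P, fun i => W (v i), inferInstance, ⟨fun I => ⟨?_⟩⟩,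
    fun i => Lp.memLp _, hmean, fun i j => ?_⟩
  · have hm : AEMeasurable (fun ω => I.restrict fun i => W (v i) ω) P := by
      rw [aemeasurable_pi_iff]
      exact fun i => (hW (v i)).aemeasurable
    refine isGaussian_of_map_eq_gaussianReal fun L => ?_
    -- A linear functional of the vector of the `W (v i)` is almost surely `W` at the same
    -- combination of the `v i`, hence a centred Gaussian variable with this variance.
    refine ⟨0, ‖∑ i : I, L (Pi.single i 1) • v i‖₊ ^ 2, ?_⟩
    rw [AEMeasurable.map_map_of_aemeasurable (by fun_prop) hm, ← (hW _).map_eq]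
    refine Measure.map_congr ?_
    have h1 : W (∑ i : I, L (Pi.single i 1) • v i) = ∑ i : I, L (Pi.single i 1) • W (v i) := by
      rw [map_sum]
      exact Finset.sum_congr rfl fun i _ => map_smul W _ _
    have h2 : ∀ᵐ ω ∂P, ∀ i : I, (L (Pi.single i 1) • W (v i) : Lp ℝ 2 P) ω =
        L (Pi.single i 1) * W (v i) ω := by
      rw [ae_all_iff]
      intro i
      filter_upwards [Lp.coeFn_smul (L (Pi.single i 1)) (W (v i))] with ω h3
      rw [h3, Pi.smul_apply, smul_eq_mul]
    rw [h1]
    filter_upwards [Lp.coeFn_fun_finsetSum Finset.univ fun i : I => L (Pi.single i 1) • W (v i), h2]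
      with ω h3 h4
    rw [h3, Finset.sum_congr rfl fun i _ => h4 i, Function.comp_apply]
    refine ((L : (I → ℝ) →ₗ[ℝ] ℝ).pi_apply_eq_sum_univ _).trans ?_
    refine Finset.sum_congr rfl fun i _ => ?_
    have h5 : (fun j => if i = j then (1 : ℝ) else 0) = Pi.single i 1 := by
      ext j
      simp [Pi.single_apply, eq_comm]
    rw [smul_eq_mul, mul_comm, h5]
    rfl
  · rw [covariance, hmean, hmean, ← hv i j, ← W.inner_map_map, L2.inner_def]
    exact integral_congr_ae (Eventually.of_forall fun ω => by simp [mul_comm])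

/-! ### Discrete cubes in the sphere, Walsh coefficients and Bernstein polynomials. -/

section CubeBernstein

/-- The vertices `∑ j, (ε j / √N) • e j` work. What matters is that the Gram matrix depends only on
the product `ε * ε'` in the group of signs. -/
theorem exists_cube_in_sphere (N : ℕ) (hN : N ≠ 0) :
    ∃ u : (Fin N → ℤˣ) → SphereInf, ∀ ε ε' : Fin N → ℤˣ,
      inner ℝ (u ε : ℓ²(ℕ, ℝ)) (u ε' : ℓ²(ℕ, ℝ)) = (∑ j, (((ε * ε') j : ℤ) : ℝ)) / N := by
  have hN' : (0 : ℝ) < N := by positivity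
  let e : Fin N → ℓ²(ℕ, ℝ) := fun j => lp.single 2 (j : ℕ) (1 : ℝ)
  have he : Orthonormal ℝ e := by
    rw [orthonormal_iff_ite]
    intro i j
    simp only [e, lp.inner_single_left, lp.single_apply]
    by_cases h : i = j
    · subst h; simp
    · have : (i : ℕ) ≠ j := fun h' => h (Fin.ext h')
      simp [h, this]
  let v : (Fin N → ℤˣ) → ℓ²(ℕ, ℝ) := fun ε => ∑ j, (((ε j : ℤ) : ℝ) / √N) • e j
  have hv (ε ε' : Fin N → ℤˣ) : inner ℝ (v ε) (v ε') = (∑ j, (((ε * ε') j : ℤ) : ℝ)) / N := by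
    simp only [v]
    rw [he.inner_sum, Finset.sum_div]
    refine Finset.sum_congr rfl fun j _ => ?_
    simp only [conj_trivial, Pi.mul_apply, Units.val_mul, Int.cast_mul]
    rw [div_mul_div_comm, Real.mul_self_sqrt hN'.le]
  have hself (ε : Fin N → ℤˣ) : inner ℝ (v ε) (v ε) = 1 := by
    rw [hv]
    have (j : Fin N) : (ε * ε) j = 1 := by
      rw [Pi.mul_apply]; exact Int.units_mul_self _
    simp [this, hN'.ne']
  refine ⟨fun ε => ⟨v ε, ?_⟩, hv⟩
  rw [mem_sphere_zero_iff_norm, norm_eq_sqrt_real_inner, hself, Real.sqrt_one]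

/-- The sum over all `k`-element sets of the Walsh coefficients of the function
`ε ↦ f ((ε₁ + ⋯ + ε_N) / N)` on the discrete cube. -/
noncomputable def walshCoeff (f : ℝ → ℝ) (N k : ℕ) : ℝ :=
  ∑ D ∈ Finset.powersetCard k (Finset.univ : Finset (Fin N)),
    (∑ ε : Fin N → ℤˣ, (∏ j ∈ D, ((ε j : ℤ) : ℝ)) * f ((∑ j, ((ε j : ℤ) : ℝ)) / N)) / 2 ^ N

theorem walshCoeff_eq_zero (f : ℝ → ℝ) {N k : ℕ} (h : N < k) : walshCoeff f N k = 0 := by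
  rw [walshCoeff, Finset.powersetCard_eq_empty.2 (by simpa using h), Finset.sum_empty]

/-- Expanding `∏ j, (1 + ρ * ε j)` over subsets `D` produces each character with weight `ρ ^
D.card`. For `|ρ| ≤ 1` the right side is the expectation of `f (mean ε)` under independent signs of
mean `ρ`. -/
theorem sum_walshCoeff_mul_pow (f : ℝ → ℝ) (N : ℕ) (ρ : ℝ) :
    ∑ k ∈ Finset.range (N + 1), walshCoeff f N k * ρ ^ k =
      ∑ ε : Fin N → ℤˣ, (∏ j, ((1 + ρ * ((ε j : ℤ) : ℝ)) / 2)) *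
        f ((∑ j, ((ε j : ℤ) : ℝ)) / N) := by
  have h1 : ∑ k ∈ Finset.range (N + 1), walshCoeff f N k * ρ ^ k =
      ∑ D : Finset (Fin N), (∑ ε : Fin N → ℤˣ, (∏ j ∈ D, ((ε j : ℤ) : ℝ)) *
        f ((∑ j, ((ε j : ℤ) : ℝ)) / N)) / 2 ^ N * ρ ^ D.card := by
    rw [← Finset.powerset_univ, Finset.sum_powerset]
    simp only [Finset.card_univ, Fintype.card_fin]
    refine Finset.sum_congr rfl fun k _ => ?_
    rw [walshCoeff, Finset.sum_mul]
    refine Finset.sum_congr rfl fun D hD => ?_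
    rw [(Finset.mem_powersetCard.1 hD).2]
  rw [h1]
  simp_rw [Finset.sum_div, Finset.sum_mul]
  rw [Finset.sum_comm]
  refine Finset.sum_congr rfl fun ε _ => ?_
  rw [Finset.prod_div_distrib, Finset.prod_one_add, Finset.powerset_univ, Finset.prod_const,
    Finset.card_univ, Fintype.card_fin, Finset.sum_div, Finset.sum_mul]
  refine Finset.sum_congr rfl fun D _ => ?_
  rw [Finset.prod_mul_distrib, Finset.prod_const]
  ring

theorem sum_cube_apply_card (N : ℕ) (g : ℕ → ℝ) :
    ∑ ε : Fin N → ℤˣ, g (Finset.univ.filter fun j => ε j = 1).card =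
      ∑ k ∈ Finset.range (N + 1), (N.choose k : ℝ) * g k := by
  have h := Finset.sum_powerset_apply_card (x := (Finset.univ : Finset (Fin N))) g
  simp only [Finset.card_univ, Fintype.card_fin, nsmul_eq_mul, Finset.powerset_univ] at h
  rw [← h]
  refine Finset.sum_bij' (fun ε _ => Finset.univ.filter fun j => ε j = 1)
    (fun S _ j => if j ∈ S then 1 else -1) (by simp) (by simp) ?_ ?_ (by simp)
  · intro ε _
    ext j
    rcases Int.units_eq_one_or (ε j) with h | h <;> simp [h]
  · intro S _
    ext j
    simp

/-- Group the sign vectors by their number `k` of plus signs: their mean is `2 * (k / N) - 1`, and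
the product weight is binomial with parameter `(1 + ρ) / 2`. -/
theorem sum_walshCoeff_eq_bernstein (f : ℝ → ℝ) {N : ℕ} (hN : N ≠ 0) (ρ : ℝ) :
    ∑ k ∈ Finset.range (N + 1), walshCoeff f N k * ρ ^ k =
      ∑ k ∈ Finset.range (N + 1), (N.choose k : ℝ) * (((1 + ρ) / 2) ^ k *
        (1 - (1 + ρ) / 2) ^ (N - k) * f (2 * ((k : ℝ) / N) - 1)) := by
  rw [sum_walshCoeff_mul_pow, ← sum_cube_apply_card N fun k => ((1 + ρ) / 2) ^ k *
        (1 - (1 + ρ) / 2) ^ (N - k) * f (2 * ((k : ℝ) / N) - 1)]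
  refine Finset.sum_congr rfl fun ε _ => ?_
  set S := Finset.univ.filter fun j => ε j = 1 with hS
  have hc : (Finset.univ.filter fun j => ¬ ε j = 1).card = N - S.card := by
    have := Finset.card_filter_add_card_filter_not (s := (Finset.univ : Finset (Fin N)))
      (p := fun j => ε j = 1)
    simp only [Finset.card_univ, Fintype.card_fin, ← hS] at this
    omega
  have hle : S.card ≤ N := by simpa using Finset.card_le_univ S
  have hone : ∀ j ∈ Finset.univ.filter fun j => ¬ ε j = 1, ε j = -1 := fun j hj =>
    (Int.units_eq_one_or (ε j)).resolve_left (Finset.mem_filter.1 hj).2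
  have hone' : ∀ j ∈ S, ε j = 1 := fun j hj => (Finset.mem_filter.1 hj).2
  congr 1
  · rw [← Finset.prod_filter_mul_prod_filter_not Finset.univ (fun j => ε j = 1)]
    congr 1
    · rw [Finset.prod_congr rfl fun j hj => by rw [hone' j hj], Finset.prod_const]
      simp [hS]
    · rw [Finset.prod_congr rfl fun j hj => by rw [hone j hj], Finset.prod_const, hc]
      congr 1
      push_cast
      ring
  · congr 1
    rw [← Finset.sum_filter_add_sum_filter_not Finset.univ (fun j => ε j = 1),
      Finset.sum_congr rfl fun j hj => by rw [hone' j hj],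
      Finset.sum_congr rfl fun j (hj : j ∈ Finset.univ.filter fun j => ¬ ε j = 1) => by
        rw [hone j hj],
      Finset.sum_const, Finset.sum_const, hc]
    have hN' : (N : ℝ) ≠ 0 := by exact_mod_cast hN
    simp [Nat.cast_sub hle]
    field_simp
    ring

theorem tendsto_sum_walshCoeff {f : ℝ → ℝ} (hf : ContinuousOn f (Set.Icc (-1) 1)) {ρ : ℝ}
    (hρ : ρ ∈ Set.Icc (-1 : ℝ) 1) :
    Tendsto (fun N => ∑ k ∈ Finset.range (N + 1), walshCoeff f N k * ρ ^ k) atTop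
      (𝓝 (f ρ)) := by
  let g : C(unitInterval, ℝ) := ⟨fun p => f (2 * (p : ℝ) - 1), by
    refine hf.comp_continuous (by fun_prop) fun p => ?_
    have := p.2.1; have := p.2.2
    constructor <;> linarith⟩
  let p : unitInterval := ⟨(1 + ρ) / 2, by constructor <;> linarith [hρ.1, hρ.2]⟩
  have h := (continuous_eval_const (F := C(unitInterval, ℝ)) p).tendsto g |>.comp
    (bernsteinApproximation_uniform g)
  have hg : g p = f ρ := by simp only [g, p, ContinuousMap.coe_mk]; congr 1; ring
  rw [hg] at h
  refine h.congr' ?_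
  filter_upwards [eventually_ne_atTop 0] with N hN
  rw [sum_walshCoeff_eq_bernstein f hN, Function.comp_apply, bernsteinApproximation.apply,
    Finset.sum_range]
  refine Finset.sum_congr rfl fun k _ => ?_
  simp only [bernstein_apply, bernstein.z, g, p, ContinuousMap.coe_mk, smul_eq_mul]
  ring

/-- A character `χ` of the sign group satisfies `χ ε * χ ε' = χ (ε * ε')`, so the positive
semidefinite double sum of `χ ε * χ ε' * F (mean (ε * ε'))` over the cube collapses to `2 ^ N` times
a single sum, the unnormalised Walsh coefficient. -/
theorem posSemidef_walshCoeff {J : Type*} {F : J → J → ℝ → ℝ}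
    (hF : (Matrix.of fun a b : SphereInf × J =>
      F a.2 b.2 (inner ℝ (a.1 : ℓ²(ℕ, ℝ)) (b.1 : ℓ²(ℕ, ℝ)))).PosSemidef)
    {N : ℕ} (hN : N ≠ 0) (k : ℕ) :
    (Matrix.of fun p q => walshCoeff (F p q) N k).PosSemidef := by
  obtain ⟨u, hu⟩ := exists_cube_in_sphere N hN
  have key (D : Finset (Fin N)) : (Matrix.of fun p q => (∑ ε : Fin N → ℤˣ,
      (∏ j ∈ D, ((ε j : ℤ) : ℝ)) * F p q ((∑ j, ((ε j : ℤ) : ℝ)) / N)) / 2 ^ N).PosSemidef := by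
    -- One factor `(2 ^ N)⁻¹` is the normalisation of the Walsh coefficient, the other cancels the
    -- free sum over `ε`.
    have h1 := (Matrix.posSemidef_weighted_sum hF (fun ε : Fin N → ℤˣ =>
      ∏ j ∈ D, ((ε j : ℤ) : ℝ)) u).smul (a := (((2 : ℝ) ^ N)⁻¹) ^ 2) (by positivity)
    convert h1 using 1
    ext p q
    simp only [Matrix.of_apply, Matrix.smul_apply, hu, smul_eq_mul]
    have h2 (ε : Fin N → ℤˣ) : ∑ ε' : Fin N → ℤˣ, (∏ j ∈ D, ((ε j : ℤ) : ℝ)) *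
        (∏ j ∈ D, ((ε' j : ℤ) : ℝ)) * F p q ((∑ j, (((ε * ε') j : ℤ) : ℝ)) / N) =
        ∑ ε : Fin N → ℤˣ, (∏ j ∈ D, ((ε j : ℤ) : ℝ)) * F p q ((∑ j, ((ε j : ℤ) : ℝ)) / N) := by
      -- Substituting `ε * ε'` for `ε'` removes `ε` from the argument of `F p q`, since every sign
      -- squares to one.
      rw [← Equiv.sum_comp (Equiv.mulLeft ε)]
      refine Finset.sum_congr rfl fun ε' _ => ?_
      simp only [Equiv.coe_mulLeft]
      rw [← Finset.prod_mul_distrib]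
      have h3 : ε * (ε * ε') = ε' := by
        rw [← mul_assoc]
        ext j
        simp
      rw [h3]
      congr 1
      refine Finset.prod_congr rfl fun j _ => ?_
      rw [Pi.mul_apply, Units.val_mul, Int.cast_mul, ← mul_assoc]
      have h4 : ((ε j : ℤ) : ℝ) * ((ε j : ℤ) : ℝ) = 1 := by
        exact_mod_cast Int.units_coe_mul_self (ε j)
      rw [h4, one_mul]
    rw [Finset.sum_congr rfl fun ε _ => h2 ε, Finset.sum_const, Finset.card_univ]
    have h3 : Fintype.card (Fin N → ℤˣ) = 2 ^ N := by simp
    rw [h3, nsmul_eq_mul]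
    push_cast
    field_simp
  have h := Matrix.posSemidef_sum (Finset.powersetCard k (Finset.univ : Finset (Fin N)))
    fun D _ => key D
  convert h using 1
  ext p q
  simp [walshCoeff, Matrix.sum_apply]

end CubeBernstein

/-! ### Schoenberg's theorem and power series on `[-1, 1]`. -/

section PowerSeries

theorem Ultrafilter.exists_tendsto_of_eventually_abs_le {α : Type*} (U : Ultrafilter α)
    {f : α → ℝ} {M : ℝ} (h : ∀ᶠ n in U, |f n| ≤ M) : ∃ a, Tendsto f U (𝓝 a) := by
  obtain ⟨a, -, ha⟩ := isCompact_Icc.ultrafilter_le_nhds (U.map f) (s := Set.Icc (-M) M) (by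
    rw [le_principal_iff]
    change f ⁻¹' Set.Icc (-M) M ∈ U
    filter_upwards [h] with n hn using abs_le.1 hn)
  exact ⟨a, ha⟩

/-- At `ρ = 1` all the binomial mass sits at the last node, so the Bernstein polynomial interpolates
`f` there. -/
theorem sum_walshCoeff (f : ℝ → ℝ) {N : ℕ} (hN : N ≠ 0) :
    ∑ k ∈ Finset.range (N + 1), walshCoeff f N k = f 1 := by
  have h := sum_walshCoeff_eq_bernstein f hN 1
  have hN' : (N : ℝ) ≠ 0 := by exact_mod_cast hN
  have h0 : ∑ k ∈ Finset.range (N + 1), (N.choose k : ℝ) * (((1 + 1) / 2 : ℝ) ^ k *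
        (1 - (1 + 1) / 2) ^ (N - k) * f (2 * ((k : ℝ) / N) - 1)) = f 1 := by
    rw [Finset.sum_eq_single N]
    · simp [div_self hN']
      norm_num
    · intro k hk hkN
      have h1 : N - k ≠ 0 := by
        have := Finset.mem_range.1 hk
        omega
      simp [h1]
    · simp
  rw [h0] at h
  simpa only [one_pow, mul_one] using h

theorem continuousOn_tsum_mul_pow {a : ℕ → ℝ} (ha : Summable fun n => |a n|) :
    ContinuousOn (fun ρ : ℝ => ∑' n, a n * ρ ^ n) (Set.Icc (-1) 1) := by
  refine continuousOn_tsum (fun n => by fun_prop) ha fun n ρ hρ => ?_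
  rw [norm_mul, norm_pow, Real.norm_eq_abs, Real.norm_eq_abs]
  exact mul_le_of_le_one_right (abs_nonneg _) (pow_le_one₀ (abs_nonneg _) (abs_le.2 hρ))

/-- **Schoenberg's theorem** on the Hilbert sphere, for kernels with values in the (possibly
infinite) real matrices. -/
theorem exists_posSemidef_hasSum_pow {J : Type*} {F : J → J → ℝ → ℝ}
    (hF : (Matrix.of fun a b : SphereInf × J =>
      F a.2 b.2 (inner ℝ (a.1 : ℓ²(ℕ, ℝ)) (b.1 : ℓ²(ℕ, ℝ)))).PosSemidef)
    (hc : ∀ p q, ContinuousOn (F p q) (Set.Icc (-1) 1)) :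
    ∃ b : ℕ → Matrix J J ℝ, (∀ n, (b n).PosSemidef) ∧
      ∀ p q, ∀ ρ ∈ Set.Icc (-1 : ℝ) 1, HasSum (fun n => b n p q * ρ ^ n) (F p q ρ) := by
  -- A free ultrafilter yields limits for all `k`, `p`, `q` at once; `J` may be uncountable, so a
  -- diagonal subsequence would not do.
  let U : Ultrafilter ℕ := hyperfilter ℕ
  have hU : (U : Filter ℕ) ≤ atTop := Nat.hyperfilter_le_atTop
  have hne : ∀ᶠ N in (U : Filter ℕ), N ≠ 0 := hU (eventually_ne_atTop 0)
  have hpsd {N : ℕ} (hN : N ≠ 0) (k : ℕ) := posSemidef_walshCoeff hF hN k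
  have hdiag (p : J) {N : ℕ} (hN : N ≠ 0) (k : ℕ) : 0 ≤ walshCoeff (F p p) N k :=
    (hpsd hN k).diag_nonneg (i := p)
  -- Diagonal coefficients are nonnegative with total `F p p 1`; this one bound controls all
  -- entries, uniformly in `N`, and survives in the limit.
  have hsum (p : J) {N : ℕ} (hN : N ≠ 0) (s : Finset ℕ) :
      ∑ k ∈ s, walshCoeff (F p p) N k ≤ F p p 1 := by
    rw [← sum_walshCoeff (F p p) hN,
      ← Finset.sum_filter_add_sum_filter_not s (fun k => k ∈ Finset.range (N + 1)),
      Finset.sum_eq_zero (s := s.filter fun k => ¬ k ∈ Finset.range (N + 1)), add_zero]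
    · refine Finset.sum_le_sum_of_subset_of_nonneg (fun k hk => (Finset.mem_filter.1 hk).2)
        fun k _ _ => hdiag p hN k
    · intro k hk
      have := (Finset.mem_filter.1 hk).2
      rw [Finset.mem_range] at this
      exact walshCoeff_eq_zero _ (by omega)
  have habs (p q : J) {N : ℕ} (hN : N ≠ 0) (k : ℕ) :
      |walshCoeff (F p q) N k| ≤ (F p p 1 + F q q 1) / 2 := by
    refine ((hpsd hN k).abs_apply_le p q).trans ?_
    have h1 := hsum p hN {k}
    have h2 := hsum q hN {k}
    simp only [Finset.sum_singleton] at h1 h2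
    simp only [Matrix.of_apply]
    linarith
  have hlim (k : ℕ) (p q : J) : ∃ a, Tendsto (fun N => walshCoeff (F p q) N k) U (𝓝 a) :=
    U.exists_tendsto_of_eventually_abs_le (M := (F p p 1 + F q q 1) / 2) (by
      filter_upwards [hne] with N hN using habs p q hN k)
  choose b hb using hlim
  have hbpsd (k : ℕ) : (Matrix.of (b k)).PosSemidef := by
    refine Matrix.posSemidef_of_tendsto (l := (U : Filter ℕ))
      (K := fun N => Matrix.of fun p q => walshCoeff (F p q) N k) ?_ fun p q => hb k p q
    filter_upwards [hne] with N hN using hpsd hN k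
  have hbd (p : J) : Summable fun k => b k p p := by
    refine summable_of_sum_le (c := F p p 1) (fun k => (hbpsd k).diag_nonneg (i := p)) fun s => ?_
    refine le_of_tendsto (tendsto_finsetSum s fun k _ => hb k p p) ?_
    filter_upwards [hne] with N hN using hsum p hN s
  have hbs (p q : J) : Summable fun k => |b k p q| :=
    Summable.of_nonneg_of_le (fun k => abs_nonneg _) (fun k => (hbpsd k).abs_apply_le p q)
      (((hbd p).add (hbd q)).div_const 2)
  have hbρ (p q : J) {ρ : ℝ} (hρ : ρ ∈ Set.Icc (-1 : ℝ) 1) :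
      Summable fun k => b k p q * ρ ^ k := by
    refine Summable.of_norm_bounded (hbs p q) fun k => ?_
    rw [norm_mul, norm_pow, Real.norm_eq_abs, Real.norm_eq_abs]
    exact mul_le_of_le_one_right (abs_nonneg _) (pow_le_one₀ (abs_nonneg _) (abs_le.2 hρ))
  -- Only for `|ρ| < 1` does the uniform coefficient bound give a summable, geometric majorant. The
  -- endpoints follow by continuity of both sides.
  have hIoo (p q : J) : Set.EqOn (F p q) (fun ρ => ∑' k, b k p q * ρ ^ k) (Set.Ioo (-1) 1) := by
    intro ρ hρ
    have hρ' : |ρ| < 1 := abs_lt.2 hρ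
    have h1 := (tendsto_sum_walshCoeff (hc p q) (Set.Ioo_subset_Icc_self hρ)).mono_left hU
    have h2 : Tendsto (fun N => ∑' k, walshCoeff (F p q) N k * ρ ^ k) U
        (𝓝 (∑' k, b k p q * ρ ^ k)) := by
      refine tendsto_tsum_of_dominated_convergence
        (bound := fun k => (F p p 1 + F q q 1) / 2 * |ρ| ^ k)
        ((summable_geometric_of_lt_one (abs_nonneg _) hρ').mul_left _)
        (fun k => (hb k p q).mul_const _) ?_
      filter_upwards [hne] with N hN k
      rw [norm_mul, norm_pow, Real.norm_eq_abs, Real.norm_eq_abs]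
      exact mul_le_mul_of_nonneg_right (habs p q hN k) (by positivity)
    refine tendsto_nhds_unique h1 (h2.congr fun N => ?_)
    refine tsum_eq_sum fun k hk => ?_
    rw [Finset.mem_range] at hk
    rw [walshCoeff_eq_zero _ (by omega), zero_mul]
  refine ⟨fun n => .of (b n), hbpsd, fun p q ρ hρ => ?_⟩
  have h := (hIoo p q).of_subset_closure (hc p q) (continuousOn_tsum_mul_pow (hbs p q))
    Set.Ioo_subset_Icc_self (by rw [closure_Ioo (by norm_num)])
  rw [h hρ]
  exact (hbρ p q hρ).hasSum

theorem exists_abs_le_of_tendsto_sum {a : ℕ → ℝ} {l : ℝ}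
    (h : Tendsto (fun N => ∑ n ∈ Finset.range N, a n) atTop (𝓝 l)) : ∃ M, ∀ n, |a n| ≤ M := by
  have h1 : Tendsto a atTop (𝓝 0) := by
    have := ((tendsto_add_atTop_iff_nat 1).2 h).sub h
    simpa [Finset.sum_range_succ] using this
  obtain ⟨M, hM⟩ := h1.abs.bddAbove_range
  exact ⟨M, fun n => hM ⟨n, rfl⟩⟩

variable {a : ℕ → ℝ} {f : ℝ → ℝ}

theorem hasSum_pow_of_tendsto_sum
    (h : ∀ ρ ∈ Set.Icc (-1 : ℝ) 1,
      Tendsto (fun N => ∑ n ∈ Finset.range N, a n * ρ ^ n) atTop (𝓝 (f ρ)))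
    {ρ : ℝ} (hρ : ρ ∈ Set.Ioo (-1 : ℝ) 1) : HasSum (fun n => a n * ρ ^ n) (f ρ) := by
  obtain ⟨M, hM⟩ := exists_abs_le_of_tendsto_sum (h 1 (by simp))
  simp only [one_pow, mul_one] at hM
  have hs : Summable fun n => a n * ρ ^ n := by
    refine Summable.of_norm_bounded
      ((summable_geometric_of_lt_one (abs_nonneg ρ) (abs_lt.2 hρ)).mul_left M) fun n => ?_
    rw [norm_mul, norm_pow, Real.norm_eq_abs, Real.norm_eq_abs]
    exact mul_le_mul_of_nonneg_right (hM n) (by positivity)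
  rw [← tendsto_nhds_unique hs.hasSum.tendsto_sum_nat (h ρ (Set.Ioo_subset_Icc_self hρ))]
  exact hs.hasSum

theorem tendsto_nhdsLT_one_of_tendsto_sum
    (h : ∀ ρ ∈ Set.Icc (-1 : ℝ) 1,
      Tendsto (fun N => ∑ n ∈ Finset.range N, a n * ρ ^ n) atTop (𝓝 (f ρ))) :
    Tendsto f (𝓝[<] 1) (𝓝 (f 1)) := by
  have h1 := Real.tendsto_tsum_powerSeries_nhdsWithin_lt (f := a) (l := f 1)
    (by simpa using h 1 (by simp))
  refine h1.congr' ?_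
  filter_upwards [Ioo_mem_nhdsLT (show (-1 : ℝ) < 1 by norm_num)] with ρ hρ
  exact (hasSum_pow_of_tendsto_sum h hρ).tsum_eq

/-- Abel's theorem handles `1` and, after reflecting `ρ` to `-ρ`, also `-1`; inside, convergence is
locally uniform. Only ordinary convergence is available at the endpoints. -/
theorem continuousOn_of_tendsto_sum_pow
    (h : ∀ ρ ∈ Set.Icc (-1 : ℝ) 1,
      Tendsto (fun N => ∑ n ∈ Finset.range N, a n * ρ ^ n) atTop (𝓝 (f ρ))) :
    ContinuousOn f (Set.Icc (-1) 1) := by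
  intro ρ hρ
  rcases eq_or_lt_of_le hρ.2 with rfl | h1
  · have := continuousWithinAt_Iio_iff_Iic.1
      (show ContinuousWithinAt f (Set.Iio 1) 1 from tendsto_nhdsLT_one_of_tendsto_sum h)
    exact this.mono fun x hx => hx.2
  rcases eq_or_lt_of_le hρ.1 with rfl | h2
  · have h3 : Tendsto (fun x => f (-x)) (𝓝[<] 1) (𝓝 (f (-1))) := by
      refine tendsto_nhdsLT_one_of_tendsto_sum (a := fun n => a n * (-1) ^ n)
        (f := fun x => f (-x)) fun x hx => ?_
      refine (h (-x) ⟨by linarith [hx.2], by linarith [hx.1]⟩).congr fun N => ?_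
      refine Finset.sum_congr rfl fun n _ => ?_
      rw [neg_pow x]
      ring
    have h4 : Tendsto f (𝓝[>] (-1)) (𝓝 (f (-1))) := by
      have h5 : Tendsto (fun x : ℝ => -x) (𝓝[>] (-1)) (𝓝[<] 1) := by
        simpa using tendsto_neg_nhdsGT (a := (-1 : ℝ))
      simpa [Function.comp_def] using h3.comp h5
    have := continuousWithinAt_Ioi_iff_Ici.1 (show ContinuousWithinAt f (Set.Ioi (-1)) (-1) from h4)
    exact this.mono fun x hx => hx.1
  · refine ContinuousAt.continuousWithinAt ?_
    obtain ⟨r, hr1, hr2⟩ := exists_between (abs_lt.2 ⟨h2, h1⟩)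
    have hr0 : 0 ≤ r := (abs_nonneg _).trans hr1.le
    obtain ⟨M, hM⟩ := exists_abs_le_of_tendsto_sum (h 1 (by simp))
    simp only [one_pow, mul_one] at hM
    have hcont : ContinuousOn (fun ρ : ℝ => ∑' n, a n * ρ ^ n) (Set.Icc (-r) r) := by
      refine continuousOn_tsum (fun n => by fun_prop)
        ((summable_geometric_of_lt_one hr0 hr2).mul_left M) fun n x hx => ?_
      rw [norm_mul, norm_pow, Real.norm_eq_abs, Real.norm_eq_abs]
      exact mul_le_mul (hM n) (pow_le_pow_left₀ (abs_nonneg _) (abs_le.2 hx) n) (by positivity)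
        ((abs_nonneg _).trans (hM n))
    have hmem : Set.Icc (-r) r ∈ 𝓝 ρ := Icc_mem_nhds (abs_lt.1 hr1).1 (abs_lt.1 hr1).2
    refine (hcont.continuousAt hmem).congr ?_
    filter_upwards [hmem] with x hx
    exact (hasSum_pow_of_tendsto_sum h ⟨by linarith [hx.1], by linarith [hx.2]⟩).tsum_eq

theorem eq_of_hasSum_pow {a b : ℕ → ℝ} {f : ℝ → ℝ}
    (ha : ∀ ρ ∈ Set.Ioo (-1 : ℝ) 1, HasSum (fun n => a n * ρ ^ n) (f ρ))
    (hb : ∀ ρ ∈ Set.Ioo (-1 : ℝ) 1, HasSum (fun n => b n * ρ ^ n) (f ρ)) : a = b := by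
  have key {c : ℕ → ℝ} (hc : ∀ ρ ∈ Set.Ioo (-1 : ℝ) 1, HasSum (fun n => c n * ρ ^ n) (f ρ)) :
      HasFPowerSeriesAt f (FormalMultilinearSeries.ofScalars ℝ c) 0 := by
    rw [hasFPowerSeriesAt_iff]
    filter_upwards [Ioo_mem_nhds (show (-1 : ℝ) < 0 by norm_num) one_pos] with ρ hρ
    simpa [mul_comm] using hc ρ hρ
  have h := (key ha).eq_formalMultilinearSeries (key hb)
  ext n
  simpa using congrArg (fun p => p.coeff n) h

/-- Removing the terms below `k` and dividing by `ρ ^ k` leaves `a k` plus a tail with a factor `ρ`.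
The bound involves only `M`, hence is uniform in any parameter on which `a` depends. -/
theorem abs_sub_sum_div_sub_le {a M : ℕ → ℝ} {c ρ : ℝ} (hM : Summable M) (haM : ∀ n, |a n| ≤ M n)
    (h0 : 0 < ρ) (h1 : ρ ≤ 1) (h : HasSum (fun n => a n * ρ ^ n) c) (k : ℕ) :
    |(c - ∑ n ∈ Finset.range k, a n * ρ ^ n) / ρ ^ k - a k| ≤ ρ * ∑' n, M n := by
  have hM0 (n : ℕ) : 0 ≤ M n := (abs_nonneg _).trans (haM n)
  have h2 := (hasSum_nat_add_iff' (k + 1)).2 h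
  have h3 : |c - ∑ n ∈ Finset.range (k + 1), a n * ρ ^ n| ≤ ρ ^ (k + 1) * ∑' n, M n := by
    rw [← h2.tsum_eq]
    have hs : Summable fun n => ρ ^ (k + 1) * M (n + (k + 1)) :=
      ((summable_nat_add_iff (k + 1)).2 hM).mul_left _
    rw [← Real.norm_eq_abs]
    refine (tsum_of_norm_bounded hs.hasSum fun n => ?_).trans ?_
    · rw [norm_mul, norm_pow, Real.norm_eq_abs, Real.norm_eq_abs, abs_of_pos h0, pow_add, mul_comm]
      refine mul_le_mul ?_ (haM _) (abs_nonneg _) (by positivity)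
      exact mul_le_of_le_one_left (by positivity) (pow_le_one₀ h0.le h1)
    · rw [tsum_mul_left]
      refine mul_le_mul_of_nonneg_left ?_ (by positivity)
      rw [← hM.sum_add_tsum_nat_add (k + 1)]
      exact le_add_of_nonneg_left (Finset.sum_nonneg fun n _ => hM0 n)
  have h4 : (c - ∑ n ∈ Finset.range k, a n * ρ ^ n) / ρ ^ k - a k =
      (c - ∑ n ∈ Finset.range (k + 1), a n * ρ ^ n) / ρ ^ k := by
    rw [Finset.sum_range_succ]
    field_simp
    ring
  rw [h4, abs_div, abs_of_pos (pow_pos h0 k), div_le_iff₀ (pow_pos h0 k)]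
  refine h3.trans_eq ?_
  ring

/-- If the sum of a power series with uniformly summable coefficients depends continuously on a
parameter, then so do the coefficients. -/
theorem continuous_coeff_of_continuous_sum {T : Type*} [TopologicalSpace T] {a : ℕ → T → ℝ}
    {M : ℕ → ℝ} {c : ℝ → T → ℝ} (hM : Summable M) (haM : ∀ n t, |a n t| ≤ M n)
    (hc : ∀ ρ ∈ Set.Ioo (0 : ℝ) 1, Continuous (c ρ))
    (h : ∀ ρ ∈ Set.Ioo (0 : ℝ) 1, ∀ t, HasSum (fun n => a n t * ρ ^ n) (c ρ t)) (k : ℕ) :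
    Continuous (a k) := by
  induction k using Nat.strong_induction_on with
  | _ k ih =>
    have hmem (N : ℕ) : (1 : ℝ) / (N + 2) ∈ Set.Ioo (0 : ℝ) 1 := by
      refine ⟨by positivity, ?_⟩
      rw [div_lt_one (by positivity)]
      have : (0 : ℝ) ≤ N := by positivity
      linarith
    have hlim : Tendsto (fun N : ℕ => (1 : ℝ) / (N + 2) * ∑' n, M n) atTop (𝓝 0) := by
      have h1 := (tendsto_add_atTop_iff_nat 1).2 (tendsto_one_div_add_atTop_nhds_zero_nat (𝕜 := ℝ))
      have h2 := h1.mul_const (∑' n, M n)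
      rw [zero_mul] at h2
      refine h2.congr fun N => ?_
      push_cast
      ring_nf
    -- Taking `ρ = 1 / (N + 2)`, always strictly between `0` and `1`, exhibits `a k` as a uniform
    -- limit of functions that are continuous by the induction hypothesis.
    have hu : TendstoUniformly (fun (N : ℕ) t => (c (1 / (N + 2)) t -
        ∑ n ∈ Finset.range k, a n t * (1 / ((N : ℝ) + 2)) ^ n) / (1 / ((N : ℝ) + 2)) ^ k) (a k)
        atTop := by
      rw [Metric.tendstoUniformly_iff]
      intro ε hε
      filter_upwards [hlim.eventually (gt_mem_nhds hε)] with N hN t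
      rw [dist_comm, Real.dist_eq]
      exact (abs_sub_sum_div_sub_le hM (fun n => haM n t) (hmem N).1 (hmem N).2.le
        (h _ (hmem N) t) k).trans_lt hN
    refine hu.continuous (Eventually.frequently (Eventually.of_forall fun N => ?_))
    refine ((hc _ (hmem N)).sub (continuous_finsetSum _ fun n hn => ?_)).div_const _
    exact (ih n (Finset.mem_range.1 hn)).mul_const _

end PowerSeries

/-! ### Covariance kernels of stationary processes and isotropic fields. -/

section CovarianceKernel

theorem Matrix.PosSemidef.sq_apply_le {ι : Type*} {K : Matrix ι ι ℝ} (hK : K.PosSemidef)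
    (i j : ι) : K i j ^ 2 ≤ K i i * K j j := by
  have h (x : ℝ) : 0 ≤ K i i * (x * x) + 2 * K i j * x + K j j := by
    have h1 := hK.sum_mul_mul_nonneg ![i, j] ![x, 1]
    have h3 := hK.apply_comm i j
    simp [Fin.sum_univ_two] at h1
    rw [← h3] at h1
    linarith
  have := discrim_le_zero h
  rw [discrim] at this
  linarith

/-- Cauchy–Schwarz for the covariance of `X` and `Y' a - Y`, whose variance is at most its second
moment. -/
theorem tendsto_covariance_of_tendsto_integral_sq {Ω α : Type*} [MeasurableSpace Ω]
    {P : Measure Ω} [IsProbabilityMeasure P] {l : Filter α} {X Y : Ω → ℝ} {Y' : α → Ω → ℝ}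
    (hX : MemLp X 2 P) (hY : MemLp Y 2 P) (hY' : ∀ a, MemLp (Y' a) 2 P)
    (h : Tendsto (fun a => ∫ ω, (Y' a ω - Y ω) ^ 2 ∂P) l (𝓝 0)) :
    Tendsto (fun a => cov[X, Y' a; P]) l (𝓝 cov[X, Y; P]) := by
  have h1 (a : α) : |cov[X, Y' a; P] - cov[X, Y; P]| ≤
      √(cov[X, X; P] * ∫ ω, (Y' a ω - Y ω) ^ 2 ∂P) := by
    have hD : MemLp (Y' a - Y) 2 P := (hY' a).sub hY
    rw [← covariance_sub_right hX (hY' a) hY]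
    have hmem : ∀ i, MemLp ((![X, Y' a - Y] : Fin 2 → Ω → ℝ) i) 2 P := by
      intro i
      fin_cases i
      · exact hX
      · exact hD
    have h2 := (posSemidef_covariance hmem).sq_apply_le 0 1
    simp only [Matrix.of_apply, Matrix.cons_val_zero, Matrix.cons_val_one] at h2
    refine Real.abs_le_sqrt (h2.trans ?_)
    refine mul_le_mul_of_nonneg_left ?_ (integral_nonneg fun ω => mul_self_nonneg _)
    rw [covariance_self hD.1.aemeasurable]
    exact variance_le_expectation_sq hD.1
  rw [tendsto_iff_norm_sub_tendsto_zero]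
  refine squeeze_zero (fun _ => norm_nonneg _) h1 ?_
  have h3 := (h.const_mul cov[X, X; P]).sqrt
  simpa using h3

variable {T : Type*} [AddCommGroup T] {m : ℕ}

/-- The scalar covariance kernel on `T × Fin m` of a process with stationary covariance matrix
function `B`. -/
def stationaryKernel (B : T → Matrix (Fin m) (Fin m) ℝ) : Matrix (T × Fin m) (T × Fin m) ℝ :=
  .of fun p q => B (p.1 - q.1) p.2 q.2

theorem stationaryKernel_apply (B : T → Matrix (Fin m) (Fin m) ℝ) (p q : T × Fin m) :
    stationaryKernel B p q = B (p.1 - q.1) p.2 q.2 := rfl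

/-- The scalar covariance kernel on `SphereInf × (T × Fin m)` of an isotropic stationary field with
covariance matrix function `C`. -/
noncomputable def isotropicKernel (C : ℝ → T → Matrix (Fin m) (Fin m) ℝ) :
    Matrix (SphereInf × (T × Fin m)) (SphereInf × (T × Fin m)) ℝ :=
  .of fun a b => C (sphericalDist a.1 b.1) (a.2.1 - b.2.1) a.2.2 b.2.2

variable {B : T → Matrix (Fin m) (Fin m) ℝ}

theorem abs_apply_le_of_posSemidef_stationaryKernel (hB : (stationaryKernel B).PosSemidef)
    (t : T) (i j : Fin m) : |B t i j| ≤ (B 0 i i + B 0 j j) / 2 := by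
  simpa [stationaryKernel_apply] using hB.abs_apply_le (t, i) (0, j)

theorem apply_neg_of_posSemidef_stationaryKernel (hB : (stationaryKernel B).PosSemidef)
    (t : T) (i j : Fin m) : B (-t) i j = B t j i := by
  simpa [stationaryKernel_apply] using hB.apply_comm (0, i) (t, j)

theorem diag_nonneg_of_posSemidef_stationaryKernel (hB : (stationaryKernel B).PosSemidef)
    (i : Fin m) : 0 ≤ B 0 i i := by
  simpa [stationaryKernel_apply] using hB.diag_nonneg (i := (0, i))

theorem IsIsotropicStationary.posSemidef {Ω : Type*} [MeasurableSpace Ω] {P : Measure Ω}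
    [IsProbabilityMeasure P] {Z : SphereInf → T → Ω → EuclideanSpace ℝ (Fin m)}
    {C : ℝ → T → Matrix (Fin m) (Fin m) ℝ} (h : IsIsotropicStationary P Z C) :
    (isotropicKernel C).PosSemidef := by
  have h1 := posSemidef_covariance (P := P)
    (X := fun (a : SphereInf × (T × Fin m)) ω => Z a.1 a.2.1 ω a.2.2)
    fun a => (h.memLp a.1 a.2.1).eval_piLp a.2.2
  convert h1 using 1
  ext a b
  exact (h.cov_eq _ _ _ _ _ _).symm

end CovarianceKernel

/-! ### Gaussian and elliptically contoured realisations of positive semidefinite kernels. -/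

section GaussianConstruction

/-- A positive semidefinite kernel on `S × Fin m` is the covariance kernel of a centred Gaussian
`m`-variate process whose finite-dimensional distributions are elliptically contoured. -/
theorem Matrix.PosSemidef.exists_multivariate_gaussian {S : Type} {m : ℕ}
    {K : Matrix (S × Fin m) (S × Fin m) ℝ} (hK : K.PosSemidef) :
    ∃ (Ω : Type) (_ : MeasurableSpace Ω) (P : Measure Ω)
      (W : S → Ω → EuclideanSpace ℝ (Fin m)), IsProbabilityMeasure P ∧ (∀ s, MemLp (W s) 2 P) ∧
      (∀ s, ∫ ω, W s ω ∂P = 0) ∧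
      (∀ s t i j, cov[fun ω => W s ω i, fun ω => W t ω j; P] = K (s, i) (t, j)) ∧
      IsGaussianProcess W P ∧
      ∀ I : Finset S, IsEllipticallyContoured P (fun ω (p : I × Fin m) => W p.1 ω p.2) := by
  classical
  obtain ⟨Ω, _, P, X, _, hX, hmem, hmean, hcov⟩ := hK.exists_isGaussianProcess
  refine ⟨Ω, inferInstance, P, fun s ω => WithLp.toLp 2 fun i => X (s, i) ω, inferInstance,
    fun s => ?_, fun s => ?_, fun s t i j => hcov _ _, ?_, fun I => ⟨?_, ?_⟩⟩
  · exact memLp_piLp_iff.2 fun i => hmem (s, i)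
  · ext i
    rw [eval_integral_piLp fun i => (hmem (s, i)).integrable one_le_two]
    exact hmean _
  · refine hX.of_isGaussianProcess fun s => ?_
    refine ⟨Finset.univ.image fun i => (s, i), LinearMap.toContinuousLinearMap
      { toFun := fun x => WithLp.toLp 2 fun i => x ⟨(s, i), by simp⟩
        map_add' := fun x y => by ext; simp
        map_smul' := fun c x => by ext; simp }, fun ω => ?_⟩
    ext i
    simp
  · rw [aemeasurable_pi_iff]
    exact fun p => (hmem _).1.aemeasurable
  · let f : I × Fin m → S × Fin m := fun p => (p.1, p.2)
    -- The generator is the Gaussian one: `a ⬝ᵥ X` is a centred real Gaussian variable whose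
    -- variance is the quadratic form of the submatrix, and its characteristic function is evaluated
    -- at `1`.
    refine ⟨0, K.submatrix f f, fun u => Complex.exp (-u / 2), hK.submatrix f, fun a => ?_⟩
    have hg : IsGaussianProcess (fun (_ : Unit) ω => ∑ p, a p * X (f p) ω) P := by
      refine hX.of_isGaussianProcess fun _ => ?_
      refine ⟨Finset.univ.image f, LinearMap.toContinuousLinearMap
        { toFun := fun x => ∑ p, a p * x ⟨f p, by simp⟩
          map_add' := fun x y => by simp [mul_add, Finset.sum_add_distrib]
          map_smul' := fun c x => by simp [Finset.mul_sum, mul_left_comm] }, fun ω => ?_⟩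
      simp
    have hl := (hg.hasGaussianLaw_eval ()).map_eq_gaussianReal
    have hm : AEMeasurable (fun ω => ∑ p, a p * X (f p) ω) P :=
      (hg.hasGaussianLaw_eval ()).aemeasurable
    have hE : ∫ ω, ∑ p, a p * X (f p) ω ∂P = 0 := by
      rw [integral_finsetSum _ fun p _ => ((hmem _).integrable one_le_two).const_mul _]
      simp [integral_const_mul, hmean]
    have hV : Var[fun ω => ∑ p, a p * X (f p) ω; P] = a ⬝ᵥ (K.submatrix f f).mulVec a := by
      rw [← covariance_self hm, covariance_fun_sum_fun_sum (fun p => (hmem _).const_mul _)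
        fun p => (hmem _).const_mul _]
      simp only [covariance_const_mul_left, covariance_const_mul_right, hcov, dotProduct,
        Matrix.mulVec, Matrix.submatrix_apply, Finset.mul_sum]
      exact Finset.sum_congr rfl fun p _ => Finset.sum_congr rfl fun q _ => by ring
    have hchar := congrArg (fun μ => charFun μ 1) hl
    simp only [charFun_gaussianReal] at hchar
    rw [charFun_apply_real, integral_map hm (by fun_prop), hE, hV] at hchar
    have hpos : 0 ≤ a ⬝ᵥ (K.submatrix f f).mulVec a := by
      rw [← hV]; exact variance_nonneg _ _
    simp only [Real.coe_toNNReal _ hpos] at hchar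
    calc ∫ ω, Complex.exp (Complex.I * ((a ⬝ᵥ fun p => X (f p) ω : ℝ) : ℂ)) ∂P
        = ∫ ω, Complex.exp (((1 : ℝ) : ℂ) * ((∑ p, a p * X (f p) ω : ℝ) : ℂ) * Complex.I) ∂P := by
          simp [dotProduct, mul_comm]
      _ = _ := by
          rw [hchar]
          simp
          ring_nf

theorem isStationaryCovariance_iff_posSemidef {T : Type} [AddCommGroup T] {m : ℕ}
    {B : T → Matrix (Fin m) (Fin m) ℝ} :
    IsStationaryCovariance B ↔ (stationaryKernel B).PosSemidef := by
  constructor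
  · rintro ⟨Ω, _, P, W, _, hW, -, hcov⟩
    have h1 := posSemidef_covariance (P := P) (X := fun (a : T × Fin m) ω => W a.1 ω a.2)
      fun a => (hW a.1).eval_piLp a.2
    convert h1 using 1
    ext a b
    exact (hcov _ _ _ _).symm
  · intro h
    obtain ⟨Ω, _, P, W, hP, hmem, hmean, hcov, -⟩ := h.exists_multivariate_gaussian
    exact ⟨Ω, inferInstance, P, W, hP, hmem, ⟨0, hmean⟩, hcov⟩

theorem exists_gaussian_field_of_posSemidef {T : Type} [AddCommGroup T] {m : ℕ}
    {C : ℝ → T → Matrix (Fin m) (Fin m) ℝ} (hC : (isotropicKernel C).PosSemidef) :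
    IsGaussianFieldCovariance C ∧ IsEllipticalFieldCovariance C := by
  let e : (SphereInf × T) × Fin m → SphereInf × (T × Fin m) := fun p => (p.1.1, (p.1.2, p.2))
  obtain ⟨Ω, _, P, W, hP, hmem, hmean, hcov, hg, he⟩ :=
    (hC.submatrix e).exists_multivariate_gaussian
  have h : IsIsotropicStationary P (fun x t => W (x, t)) C :=
    ⟨fun x t => hmem _, ⟨0, fun x t => hmean _⟩, fun x y s t i j => hcov _ _ _ _⟩
  exact ⟨⟨Ω, inferInstance, P, fun x t => W (x, t), hP, h, hg⟩,
    ⟨Ω, inferInstance, P, fun x t => W (x, t), hP, h, he⟩⟩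

end GaussianConstruction

/-! ### Series in powers of the cosine with stationary covariance coefficients. -/

section CosineSeries

theorem seriesConvergesTo_iff {m : ℕ} {A : ℕ → Matrix (Fin m) (Fin m) ℝ}
    {S : Matrix (Fin m) (Fin m) ℝ} :
    SeriesConvergesTo A S ↔
      ∀ i j, Tendsto (fun N => ∑ n ∈ Finset.range N, A n i j) atTop (𝓝 (S i j)) := by
  unfold SeriesConvergesTo
  refine tendsto_pi_nhds.trans (forall_congr' fun i => tendsto_pi_nhds.trans
    (forall_congr' fun j => ?_))
  simp only [Matrix.sum_apply]

variable {T : Type*} {m : ℕ}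

theorem hasCosPowerSeries_iff {B : ℕ → T → Matrix (Fin m) (Fin m) ℝ}
    {C : ℝ → T → Matrix (Fin m) (Fin m) ℝ} :
    HasCosPowerSeries B C ↔ ∀ t i j, ∀ ρ ∈ Set.Icc (-1 : ℝ) 1,
      Tendsto (fun N => ∑ n ∈ Finset.range N, B n t i j * ρ ^ n) atTop
        (𝓝 (C (Real.arccos ρ) t i j)) := by
  constructor
  · intro h t i j ρ hρ
    have h1 := seriesConvergesTo_iff.1
      (h (Real.arccos ρ) ⟨Real.arccos_nonneg ρ, Real.arccos_le_pi ρ⟩ t) i j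
    simpa [Real.cos_arccos hρ.1 hρ.2, mul_comm] using h1
  · intro h θ hθ t
    refine seriesConvergesTo_iff.2 fun i j => ?_
    have h1 := h t i j (Real.cos θ) (Real.cos_mem_Icc θ)
    rw [Real.arccos_cos hθ.1 hθ.2] at h1
    simpa [mul_comm] using h1

theorem continuous_matrix_iff {X : Type*} [TopologicalSpace X]
    {f : X → Matrix (Fin m) (Fin m) ℝ} : Continuous f ↔ ∀ i j, Continuous fun x => f x i j :=
  ⟨fun h i j => h.matrix_elem i j, continuous_matrix⟩

variable [AddCommGroup T]

/-- Schoenberg's theorem with `J = T × Fin m` gives kernels `b n` on `J`, not visibly stationary.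
For index pairs with the same time difference the expanded function is the same, so uniqueness of
coefficients forces stationarity. -/
theorem exists_stationary_hasSum_pow {C : ℝ → T → Matrix (Fin m) (Fin m) ℝ}
    (hC : (isotropicKernel C).PosSemidef)
    (hc : ∀ t i j, ContinuousOn (fun ρ => C (Real.arccos ρ) t i j) (Set.Icc (-1) 1)) :
    ∃ B : ℕ → T → Matrix (Fin m) (Fin m) ℝ, (∀ n, (stationaryKernel (B n)).PosSemidef) ∧
      ∀ t i j, ∀ ρ ∈ Set.Icc (-1 : ℝ) 1,
        HasSum (fun n => B n t i j * ρ ^ n) (C (Real.arccos ρ) t i j) := by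
  obtain ⟨b, hb, hsum⟩ := exists_posSemidef_hasSum_pow
    (F := fun (p q : T × Fin m) ρ => C (Real.arccos ρ) (p.1 - q.1) p.2 q.2) hC fun p q => hc _ _ _
  refine ⟨fun n t => .of fun i j => b n (t, i) (0, j), fun n => ?_, fun t i j ρ hρ => ?_⟩
  · convert hb n using 1
    ext p q
    have h := eq_of_hasSum_pow
      (fun ρ hρ => hsum (p.1 - q.1, p.2) (0, q.2) ρ (Set.Ioo_subset_Icc_self hρ))
      (b := fun n => b n p q)
      (fun ρ hρ => by
        simpa only [sub_zero] using hsum p q ρ (Set.Ioo_subset_Icc_self hρ))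
    exact congrFun h n
  · simpa using hsum (t, i) (0, j) ρ hρ

variable {B : ℕ → T → Matrix (Fin m) (Fin m) ℝ}

/-- The diagonal of `B n 0` is nonnegative, which upgrades ordinary to unconditional convergence.
These diagonals then dominate every entry at every time. -/
theorem summable_diag_of_seriesConvergesTo (hB : ∀ n, (stationaryKernel (B n)).PosSemidef)
    {S : Matrix (Fin m) (Fin m) ℝ} (hS : SeriesConvergesTo (fun n => B n 0) S) (i : Fin m) :
    Summable fun n => B n 0 i i :=
  ((hasSum_iff_tendsto_nat_of_nonneg
    (fun n => diag_nonneg_of_posSemidef_stationaryKernel (hB n) i) _).2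
      (seriesConvergesTo_iff.1 hS i i)).summable

theorem summable_apply_mul_pow (hB : ∀ n, (stationaryKernel (B n)).PosSemidef)
    (hs : ∀ i, Summable fun n => B n 0 i i) (t : T) (i j : Fin m) {ρ : ℝ}
    (hρ : ρ ∈ Set.Icc (-1 : ℝ) 1) : Summable fun n => B n t i j * ρ ^ n := by
  refine Summable.of_norm_bounded (((hs i).add (hs j)).div_const 2) fun n => ?_
  rw [norm_mul, norm_pow, Real.norm_eq_abs, Real.norm_eq_abs]
  exact (mul_le_of_le_one_right (abs_nonneg _) (pow_le_one₀ (abs_nonneg _) (abs_le.2 hρ))).trans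
    (abs_apply_le_of_posSemidef_stationaryKernel (hB n) t i j)

theorem hasSum_of_hasCosPowerSeries {C : ℝ → T → Matrix (Fin m) (Fin m) ℝ}
    (hB : ∀ n, (stationaryKernel (B n)).PosSemidef) (hs : ∀ i, Summable fun n => B n 0 i i)
    (hBC : HasCosPowerSeries B C) (t : T) (i j : Fin m) {ρ : ℝ} (hρ : ρ ∈ Set.Icc (-1 : ℝ) 1) :
    HasSum (fun n => B n t i j * ρ ^ n) (C (Real.arccos ρ) t i j) := by
  have h := (summable_apply_mul_pow hB hs t i j hρ).hasSum
  rwa [tendsto_nhds_unique h.tendsto_sum_nat (hasCosPowerSeries_iff.1 hBC t i j ρ hρ)] at h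

theorem inner_mem_Icc (x y : SphereInf) :
    inner ℝ (x : ℓ²(ℕ, ℝ)) (y : ℓ²(ℕ, ℝ)) ∈ Set.Icc (-1 : ℝ) 1 := by
  have h := abs_real_inner_le_norm (x : ℓ²(ℕ, ℝ)) (y : ℓ²(ℕ, ℝ))
  rw [norm_eq_of_mem_sphere, norm_eq_of_mem_sphere, one_mul] at h
  exact abs_le.1 h

/-- Each term is the Schur product of a stationary kernel with a power of the Gram kernel of the
sphere. -/
theorem posSemidef_isotropicKernel_of_hasSum {C : ℝ → T → Matrix (Fin m) (Fin m) ℝ}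
    (hB : ∀ n, (stationaryKernel (B n)).PosSemidef)
    (h : ∀ t i j, ∀ ρ ∈ Set.Icc (-1 : ℝ) 1,
      HasSum (fun n => B n t i j * ρ ^ n) (C (Real.arccos ρ) t i j)) :
    (isotropicKernel C).PosSemidef := by
  refine Matrix.posSemidef_of_hasSum (K := fun n =>
    ((stationaryKernel (B n)).submatrix Prod.snd Prod.snd).hadamard
      (.of fun a b : SphereInf × (T × Fin m) =>
        inner ℝ (a.1 : ℓ²(ℕ, ℝ)) (b.1 : ℓ²(ℕ, ℝ)) ^ n)) (fun n => ?_) fun a b => ?_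
  · exact ((hB n).submatrix _).hadamard
      ((posSemidef_inner fun a : SphereInf × (T × Fin m) => (a.1 : ℓ²(ℕ, ℝ))).map_pow n)
  · exact h (a.2.1 - b.2.1) a.2.2 b.2.2 _ (inner_mem_Icc a.1 b.1)

/-- Reversing time, `t ↦ -t`, is a reindexing of the kernel, and an average of two positive
semidefinite kernels is again one. -/
theorem posSemidef_stationaryKernel_symmPart {B : T → Matrix (Fin m) (Fin m) ℝ}
    (hB : (stationaryKernel B).PosSemidef) :
    (stationaryKernel fun t => (1 / 2 : ℝ) • (B t + B (-t))).PosSemidef := by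
  have h := (hB.add (hB.submatrix fun p : T × Fin m => (-p.1, p.2))).smul
    (a := (1 / 2 : ℝ)) (by norm_num)
  convert h using 1
  ext p q
  simp [stationaryKernel_apply, add_comm, sub_eq_add_neg]
  ring

theorem continuous_coeff_of_continuous [TopologicalSpace T]
    {C : ℝ → T → Matrix (Fin m) (Fin m) ℝ}
    (hB : ∀ n, (stationaryKernel (B n)).PosSemidef) (hs : ∀ i, Summable fun n => B n 0 i i)
    (hBC : HasCosPowerSeries B C) (hC : ∀ θ ∈ Set.Icc (0 : ℝ) Real.pi, Continuous (C θ)) (n : ℕ) :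
    Continuous (B n) := by
  refine continuous_matrix_iff.2 fun i j => ?_
  refine continuous_coeff_of_continuous_sum (a := fun n t => B n t i j)
    (c := fun ρ t => C (Real.arccos ρ) t i j) (((hs i).add (hs j)).div_const 2)
    (fun n t => abs_apply_le_of_posSemidef_stationaryKernel (hB n) t i j) (fun ρ _ => ?_)
    (fun ρ hρ t => hasSum_of_hasCosPowerSeries hB hs hBC t i j ⟨by linarith [hρ.1], hρ.2.le⟩) n
  exact continuous_matrix_iff.1
    (hC _ ⟨Real.arccos_nonneg ρ, Real.arccos_le_pi ρ⟩) i j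

theorem continuous_of_continuous_coeff [TopologicalSpace T]
    {C : ℝ → T → Matrix (Fin m) (Fin m) ℝ}
    (hB : ∀ n, (stationaryKernel (B n)).PosSemidef) (hs : ∀ i, Summable fun n => B n 0 i i)
    (hBC : HasCosPowerSeries B C) (hc : ∀ n, Continuous (B n)) {θ : ℝ}
    (hθ : θ ∈ Set.Icc (0 : ℝ) Real.pi) : Continuous (C θ) := by
  refine continuous_matrix_iff.2 fun i j => ?_
  have h1 (t : T) : C θ t i j = ∑' n, B n t i j * Real.cos θ ^ n := by
    have := hasSum_of_hasCosPowerSeries hB hs hBC t i j (Real.cos_mem_Icc θ)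
    rw [Real.arccos_cos hθ.1 hθ.2] at this
    exact this.tsum_eq.symm
  simp_rw [h1]
  refine continuous_tsum (fun n => (continuous_matrix_iff.1 (hc n) i j).mul_const _)
    (((hs i).add (hs j)).div_const 2) fun n t => ?_
  rw [norm_mul, norm_pow, Real.norm_eq_abs, Real.norm_eq_abs]
  exact (mul_le_of_le_one_right (abs_nonneg _) (pow_le_one₀ (abs_nonneg _)
    (Real.abs_cos_le_one θ))).trans (abs_apply_le_of_posSemidef_stationaryKernel (hB n) t i j)

end CosineSeries

/-! ### Mean square continuity makes the covariance continuous in the cosine. -/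

section MeanSquareContinuity

/-- The half great circle `ρ • e 0 + √(1 - ρ ^ 2) • e 1`, seen from `e 0`. -/
theorem exists_continuous_sphere_path :
    ∃ (x : SphereInf) (y : Set.Icc (-1 : ℝ) 1 → SphereInf), Continuous y ∧
      ∀ ρ, inner ℝ (x : ℓ²(ℕ, ℝ)) (y ρ : ℓ²(ℕ, ℝ)) = ρ := by
  let e : ℕ → ℓ²(ℕ, ℝ) := fun j => lp.single 2 j (1 : ℝ)
  have h00 : inner ℝ (e 0) (e 0) = 1 := by simp [e]
  have h11 : inner ℝ (e 1) (e 1) = 1 := by simp [e]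
  have h01 : inner ℝ (e 0) (e 1) = 0 := by simp [e, lp.inner_single_left, lp.single_apply]
  have h10 : inner ℝ (e 1) (e 0) = 0 := by rw [real_inner_comm, h01]
  let v : Set.Icc (-1 : ℝ) 1 → ℓ²(ℕ, ℝ) := fun ρ => (ρ : ℝ) • e 0 + √(1 - (ρ : ℝ) ^ 2) • e 1
  have hv (ρ : Set.Icc (-1 : ℝ) 1) : v ρ ∈ Metric.sphere (0 : ℓ²(ℕ, ℝ)) 1 := by
    have h : 0 ≤ 1 - (ρ : ℝ) ^ 2 := by nlinarith [ρ.2.1, ρ.2.2]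
    have h1 : inner ℝ (v ρ) (v ρ) = 1 := by
      simp only [v, inner_add_left, inner_add_right, real_inner_smul_left, real_inner_smul_right,
        h00, h11, h01, h10]
      nlinarith [Real.mul_self_sqrt h]
    rw [mem_sphere_zero_iff_norm, norm_eq_sqrt_real_inner, h1, Real.sqrt_one]
  refine ⟨⟨e 0, ?_⟩, fun ρ => ⟨v ρ, hv ρ⟩, ?_, fun ρ => ?_⟩
  · rw [mem_sphere_zero_iff_norm, norm_eq_sqrt_real_inner, h00, Real.sqrt_one]
  · refine Continuous.subtype_mk ?_ _
    fun_prop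
  · simp only [v, inner_add_right, real_inner_smul_right, h00, h01]
    ring

theorem IsMeanSquareContinuous.continuousOn {Ω T : Type*} [MeasurableSpace Ω] [AddCommGroup T]
    {m : ℕ} {P : Measure Ω} [IsProbabilityMeasure P]
    {Z : SphereInf → T → Ω → EuclideanSpace ℝ (Fin m)} {C : ℝ → T → Matrix (Fin m) (Fin m) ℝ}
    (hms : IsMeanSquareContinuous P Z) (h : IsIsotropicStationary P Z C) (t : T) (i j : Fin m) :
    ContinuousOn (fun ρ => C (Real.arccos ρ) t i j) (Set.Icc (-1) 1) := by
  obtain ⟨x, y, hy, hxy⟩ := exists_continuous_sphere_path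
  have hmem (z : SphereInf) (s : T) (k : Fin m) : MemLp (fun ω => Z z s ω k) 2 P :=
    (h.memLp z s).eval_piLp k
  have hcov : Continuous fun z => cov[fun ω => Z x t ω i, fun ω => Z z 0 ω j; P] := by
    rw [continuous_iff_continuousAt]
    intro z
    refine tendsto_covariance_of_tendsto_integral_sq (hmem x t i) (hmem z 0 j)
      (fun z' => hmem z' 0 j) ?_
    refine squeeze_zero (fun z' => integral_nonneg fun ω => sq_nonneg _) (fun z' => ?_) (hms 0 z)
    refine integral_mono_of_nonneg (Eventually.of_forall fun ω => sq_nonneg _)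
      (((h.memLp z' 0).sub (h.memLp z 0)).integrable_norm_pow two_ne_zero)
      (Eventually.of_forall fun ω => ?_)
    have h1 := PiLp.norm_apply_le (Z z' 0 ω - Z z 0 ω) j
    rw [PiLp.sub_apply, Real.norm_eq_abs] at h1
    simpa using pow_le_pow_left₀ (abs_nonneg _) h1 2
  rw [continuousOn_iff_continuous_domRestrict]
  refine (hcov.comp hy).congr fun ρ => ?_
  rw [Function.comp_apply, h.cov_eq, sphericalDist, hxy, sub_zero]
  rfl

end MeanSquareContinuity

/-! ### Passing between fields and coefficient sequences. -/

section Equivalence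

variable {T : Type} [AddCommGroup T] {m : ℕ} {B : ℕ → T → Matrix (Fin m) (Fin m) ℝ}

theorem exists_covariance_of_isStationaryCovariance
    (hS : ∃ S, SeriesConvergesTo (fun n => B n 0) S) (hB : ∀ n, IsStationaryCovariance (B n)) :
    ∃ C, HasCosPowerSeries B C ∧ IsGaussianFieldCovariance C ∧ IsEllipticalFieldCovariance C := by
  obtain ⟨S, hS⟩ := hS
  have hB' (n : ℕ) := isStationaryCovariance_iff_posSemidef.1 (hB n)
  have hs := summable_diag_of_seriesConvergesTo hB' hS
  let C : ℝ → T → Matrix (Fin m) (Fin m) ℝ :=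
    fun θ t => .of fun i j => ∑' n, B n t i j * Real.cos θ ^ n
  have hC : ∀ t i j, ∀ ρ ∈ Set.Icc (-1 : ℝ) 1,
      HasSum (fun n => B n t i j * ρ ^ n) (C (Real.arccos ρ) t i j) := by
    intro t i j ρ hρ
    simp only [C, Matrix.of_apply, Real.cos_arccos hρ.1 hρ.2]
    exact (summable_apply_mul_pow hB' hs t i j hρ).hasSum
  exact ⟨C, hasCosPowerSeries_iff.2 fun t i j ρ hρ => (hC t i j ρ hρ).tendsto_sum_nat,
    exists_gaussian_field_of_posSemidef (posSemidef_isotropicKernel_of_hasSum hB' hC)⟩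

/-- No regularity of the field is needed: convergence of the series on all of `[-1, 1]` already
makes `C` continuous in `ρ`. Schoenberg's coefficients then coincide with the given ones by
uniqueness. -/
theorem isStationaryCovariance_of_isIsotropicStationary {Ω : Type*} [MeasurableSpace Ω]
    {P : Measure Ω} [IsProbabilityMeasure P] {Z : SphereInf → T → Ω → EuclideanSpace ℝ (Fin m)}
    {C : ℝ → T → Matrix (Fin m) (Fin m) ℝ} (hBC : HasCosPowerSeries B C)
    (h : IsIsotropicStationary P Z C) :
    (∃ S, SeriesConvergesTo (fun n => B n 0) S) ∧ ∀ n, IsStationaryCovariance (B n) := by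
  have hBC' := hasCosPowerSeries_iff.1 hBC
  refine ⟨⟨C 0 0, ?_⟩, fun n => ?_⟩
  · have := hBC 0 ⟨le_rfl, Real.pi_pos.le⟩ 0
    simpa using this
  · obtain ⟨B', hB', hsum⟩ := exists_stationary_hasSum_pow h.posSemidef
      fun t i j => continuousOn_of_tendsto_sum_pow (hBC' t i j)
    rw [isStationaryCovariance_iff_posSemidef]
    have heq : B n = B' n := by
      ext t i j
      have := eq_of_hasSum_pow (a := fun n => B n t i j)
        (fun ρ hρ => hasSum_pow_of_tendsto_sum (hBC' t i j) hρ)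
        (fun ρ hρ => hsum t i j ρ (Set.Ioo_subset_Icc_self hρ))
      exact congrFun this n
    rw [heq]
    exact hB' n

end Equivalence

theorem theorem3 {T : Type} [AddCommGroup T] [TopologicalSpace T] [IsTopologicalAddGroup T]
    (m : ℕ) :
    -- (i)
    (∀ {Ω : Type*} [MeasurableSpace Ω] (P : Measure Ω) [IsProbabilityMeasure P]
        (Z : SphereInf → T → Ω → EuclideanSpace ℝ (Fin m))
        (C : ℝ → T → Matrix (Fin m) (Fin m) ℝ),
        IsIsotropicStationary P Z C → IsMeanSquareContinuous P Z →
        ∃ B : ℕ → T → Matrix (Fin m) (Fin m) ℝ,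
          HasCosPowerSeries B (fun θ t => (1 / 2 : ℝ) • (C θ t + C θ (-t))) ∧
          (∀ t n, (B n t).IsSymm) ∧
          (∀ t, ∃ S, SeriesConvergesTo (fun n => B n t) S) ∧
          (∀ n, IsStationaryCovariance (B n)) ∧
          ((∀ θ ∈ Set.Icc (0 : ℝ) Real.pi, ∀ t, C θ (-t) = C θ t) → HasCosPowerSeries B C) ∧
          ((∀ θ ∈ Set.Icc (0 : ℝ) Real.pi, Continuous (C θ)) → ∀ n, Continuous (B n))) ∧
    -- (ii)
    (∀ B : ℕ → T → Matrix (Fin m) (Fin m) ℝ,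
        ((∃ C, HasCosPowerSeries B C ∧ IsGaussianFieldCovariance C) ↔
          (∃ S, SeriesConvergesTo (fun n => B n 0) S) ∧ ∀ n, IsStationaryCovariance (B n)) ∧
        ((∃ C, HasCosPowerSeries B C ∧ IsEllipticalFieldCovariance C) ↔
          (∃ S, SeriesConvergesTo (fun n => B n 0) S) ∧ ∀ n, IsStationaryCovariance (B n)) ∧
        ((∃ S, SeriesConvergesTo (fun n => B n 0) S) → (∀ n, IsStationaryCovariance (B n)) →
          ∀ C, HasCosPowerSeries B C →
            ((∀ θ ∈ Set.Icc (0 : ℝ) Real.pi, Continuous (C θ)) ↔ ∀ n, Continuous (B n)))) := by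
  refine ⟨?_, fun B => ⟨⟨?_, ?_⟩, ⟨?_, ?_⟩, ?_⟩⟩
  · intro Ω _ P _ Z C h hms
    obtain ⟨B, hB, hsum⟩ := exists_stationary_hasSum_pow h.posSemidef fun t i j =>
      hms.continuousOn h t i j
    -- The `B n` already expand `C` itself, but `B n (-t)` is the transpose of `B n t`; averaging
    -- the two makes the values symmetric.
    let B' : ℕ → T → Matrix (Fin m) (Fin m) ℝ := fun n t => (1 / 2 : ℝ) • (B n t + B n (-t))
    have hB' (n : ℕ) : (stationaryKernel (B' n)).PosSemidef :=
      posSemidef_stationaryKernel_symmPart (hB n)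
    have hsum' (t : T) (i j : Fin m) (ρ : ℝ) (hρ : ρ ∈ Set.Icc (-1 : ℝ) 1) :
        HasSum (fun n => B' n t i j * ρ ^ n)
          (((1 / 2 : ℝ) • (C (Real.arccos ρ) t + C (Real.arccos ρ) (-t))) i j) := by
      have h1 := ((hsum t i j ρ hρ).add (hsum (-t) i j ρ hρ)).mul_left (1 / 2 : ℝ)
      simp only [← add_mul, ← mul_assoc] at h1
      exact h1
    have hser : HasCosPowerSeries B' fun θ t => (1 / 2 : ℝ) • (C θ t + C θ (-t)) :=
      hasCosPowerSeries_iff.2 fun t i j ρ hρ => (hsum' t i j ρ hρ).tendsto_sum_nat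
    have hs (i : Fin m) : Summable fun n => B' n 0 i i := by
      simpa using (hsum' 0 i i 1 (by simp)).summable
    refine ⟨B', hser, fun t n => ?_, fun t => ?_,
      fun n => isStationaryCovariance_iff_posSemidef.2 (hB' n), fun hev θ hθ t => ?_,
      fun hc => continuous_coeff_of_continuous hB' hs hser fun θ hθ => ?_⟩
    · ext i j
      simp only [B', Matrix.transpose_apply, Matrix.smul_apply, Matrix.add_apply,
        apply_neg_of_posSemidef_stationaryKernel (hB n)]
      rw [add_comm]
    · have := hser 0 ⟨le_rfl, Real.pi_pos.le⟩ t
      exact ⟨_, by simpa using this⟩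
    · have h1 := hser θ hθ t
      beta_reduce at h1
      rwa [hev θ hθ t, ← two_smul ℝ, smul_smul, one_div_mul_cancel two_ne_zero, one_smul] at h1
    · exact ((hc θ hθ).add ((hc θ hθ).comp continuous_neg)).const_smul (1 / 2 : ℝ)
  · rintro ⟨C, hBC, Ω, _, P, Z, _, hZ, -⟩
    exact isStationaryCovariance_of_isIsotropicStationary hBC hZ
  · rintro ⟨hS, hB⟩
    obtain ⟨C, hBC, hG, -⟩ := exists_covariance_of_isStationaryCovariance hS hB
    exact ⟨C, hBC, hG⟩
  · rintro ⟨C, hBC, Ω, _, P, Z, _, hZ, -⟩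
    exact isStationaryCovariance_of_isIsotropicStationary hBC hZ
  · rintro ⟨hS, hB⟩
    obtain ⟨C, hBC, -, hE⟩ := exists_covariance_of_isStationaryCovariance hS hB
    exact ⟨C, hBC, hE⟩
  · rintro ⟨S, hS⟩ hB C hBC
    have hB' (n : ℕ) := isStationaryCovariance_iff_posSemidef.1 (hB n)
    have hs := summable_diag_of_seriesConvergesTo hB' hS
    exact ⟨continuous_coeff_of_continuous hB' hs hBC, fun hc θ hθ =>
      continuous_of_continuous_coeff hB' hs hBC hc hθ⟩
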